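/- Let $M$ be a finite-dimensional smooth manifold (Hausdorff, second countable), $\tau:TM\to M$ its tangent bundle, $\mathring TM\subset TM$ the open set of nonzero tangent vectors, and let $\mathrm{Sec}(\mathring\pi)$ be the module of smooth sections of the pull-back bundle $\mathring\pi:\mathring TM\times_M TM\to\mathring TM$. Write $\mathbf i$ for the canonical injection of $TM\times_M TM$ into $TTM$ (vertical lift), $\mathbf j:TTM\to TM\times_MTM$, $\mathbf j(w)=(v,\tau_*w)$ for $w\in T_vTM$, and $\mathbf J=\mathbf i\circ\mathbf j$. Let $(M,F)$ be a Finsler manifold: $F:TM\to\mathbb R$ is smooth on $\mathring TM$, $F(\lambda v)=\lambda F(v)$ for all $\lambda\ge 0$, and the metric tensor $g=\frac12\nabla^{\mathsf v}\nabla^{\mathsf v}F^2$ is fibrewise nondegenerate. Here $\nabla^{\mathsf v}$ is the vertical differential: $\nabla^{\mathsf v}f(X)=(\mathbf iX)f$ on functions, $\nabla^{\mathsf v}_XY=\mathbf j[\mathbf iX,\eta]$ on sections, with $\eta$ any vector field on $\mathring TM$ such that $\mathbf j\eta=Y$, and extended to tensors by the product rule, with $\nabla^{\mathsf v}A(X,\dots)=(\nabla^{\mathsf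 v}_XA)(\dots)$. Let $E=\frac12F^2$, and let $S$ be the canonical spray, i.e. the vector field that is zero on the zero vectors and is determined on $\mathring TM$ by $i_S\,d(dE\circ\mathbf J)=-dE$. Let $\mathcal H:TM\times_MTM\to TTM$ be the canonical connection, i.e. the Ehresmann connection such that over $\mathring TM$ one has $\mathcal H(\widehat X)=\frac12(X^{\mathsf c}+[X^{\mathsf v},S])$ for all vector fields $X$ on $M$, where $\widehat X(v)=(v,X(\tau(v)))$, and $X^{\mathsf v}=\mathbf i\widehat X$ and $X^{\mathsf c}$ are the vertical and complete lifts of $X$. Put $\mathcal V=\mathbf i^{-1}\circ(1-\mathcal H\circ\mathbf j)$, let $\nabla^{\mathsf h}_XY=\mathcal V[\mathcal HX,\mathbf iY]$ be the horizontal differential (with $\nabla^{\mathsf h}_Xf=(\mathcal HX)f$ on functions, extended to tensors as above), and let $\nabla_\xi Y=\nabla^{\mathsf v}_{\mathcal V\xi}Y+\nabla^{\mathsf h}_{\mathbf j\xi}Y$ be the Berwald derivative, with curvature $R^\nabla(\xi,\eta)=[\nabla_\xi,\nabla_\eta]-\nabla_{[\xi,\eta]}$. The affine curvature is $\mathbf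 H(X,Y)Z=R^\nabla(\mathcal HX,\mathcal HY)Z$; its vertical differential is written $\nabla^{\mathsf v}\mathbf H(X,Y,Z,U)=(\nabla^{\mathsf v}_X\mathbf H)(Y,Z)U$. The Landsberg tensor is $\mathbf P=-\frac12\nabla^{\mathsf h}g$, and the stretch tensor $\Sigma$ is given by $\frac12\Sigma(X,Y,Z,U)=\nabla^{\mathsf h}\mathbf P(X,Y,Z,U)-\nabla^{\mathsf h}\mathbf P(Y,X,Z,U)$. Then for all $X,Y,Z,U\in\mathrm{Sec}(\mathring\pi)$, $$\nabla^{\mathsf v}E\bigl(\nabla^{\mathsf v}\mathbf H(X,Y,Z,U)\bigr)=\Sigma(Z,Y,X,U)\quad\text{on }\mathring TM.$$ Consequently, if $(M,F)$ is R-quadratic, i.e. $\nabla^{\mathsf v}\mathbf H=0$, then $\Sigma=0$. -/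

import Mathlib

open scoped Manifold ContDiff Topology

noncomputable section

namespace Finsler

section

variable {E : Type*} [NormedAddCommGroup E] [NormedSpace ℝ E]
  {M : Type*} [TopologicalSpace M] [ChartedSpace E M] [IsManifold 𝓘(ℝ, E) ∞ M]

/-! ### The slit tangent bundle, sections of the pull-back bundle, vector fields -/

variable (E M) in
/-- The tangent manifold `TM`. -/
abbrev TM := TangentBundle 𝓘(ℝ, E) M

variable (E M) in
/-- The slit tangent manifold `T°M`: the open set of nonzero tangent vectors. -/
def slit : Set (TM E M) := {v | v.2 ≠ 0}

variable (E M) in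
/-- Sections of the pull-back bundle `T°M ×_M TM → T°M`, i.e. vector fields along the
projection. A section is carried as a function on all of `TM`; only its restriction to the open set
`slit E M` matters, and its smoothness there is the predicate `SmoothSec`. -/
abbrev Sec := (v : TM E M) → TangentSpace 𝓘(ℝ, E) v.proj

variable (E M) in
/-- Vector fields on the tangent manifold (again, for a vector field on `T°M` only the values on
`slit E M` matter). -/
abbrev Field := (v : TM E M) → TangentSpace 𝓘(ℝ, E).tangent v

/-- `X` is a smooth section over the slit tangent manifold. -/
def SmoothSec (X : Sec E M) : Prop :=
  ContMDiffOn 𝓘(ℝ, E).tangent 𝓘(ℝ, E).tangent ∞ (fun v => (⟨v.proj, X v⟩ : TM E M)) (slit E M)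

/-- A vector field on the tangent manifold, as a map from `TM` to `TTM`. -/
def Field.toMap (ξ : Field E M) (v : TM E M) : TangentBundle 𝓘(ℝ, E).tangent (TM E M) := ⟨v, ξ v⟩

/-- `ξ` is a smooth vector field on the slit tangent manifold. -/
def SmoothField (ξ : Field E M) : Prop :=
  ContMDiffOn 𝓘(ℝ, E).tangent 𝓘(ℝ, E).tangent.tangent ∞ (Field.toMap ξ) (slit E M)

/-- `X` is a smooth vector field on `M`. -/
def SmoothVectorField (X : (p : M) → TangentSpace 𝓘(ℝ, E) p) : Prop :=
  ContMDiff 𝓘(ℝ, E) 𝓘(ℝ, E).tangent ∞ (fun p => (⟨p, X p⟩ : TM E M))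

/-- The basic section `v ↦ (v, X (τ v))` induced by a vector field `X` on `M`. -/
def basic (X : (p : M) → TangentSpace 𝓘(ℝ, E) p) : Sec E M := fun v => X v.proj

/-- The derivative `ξ f` of a function `f` on the tangent manifold along a vector field `ξ`. -/
def applyField (ξ : Field E M) (f : TM E M → ℝ) : TM E M → ℝ :=
  fun v => (mfderiv 𝓘(ℝ, E).tangent 𝓘(ℝ, ℝ) f v (ξ v) : ℝ)

/-- The Lie bracket of vector fields on the tangent manifold. -/
def bracket (ξ η : Field E M) : Field E M :=
  fun v => VectorField.mlieBracket 𝓘(ℝ, E).tangent ξ η v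

/-! ### The canonical maps `i`, `j`, `J` -/

/-- The canonical injection `i`, fibrewise: `vert v w` is the velocity at `t = 0` of `t ↦ v + t w`,
i.e. the image of `w` under the derivative at `v` of the inclusion of the tangent space at
`τ v` into `TM`. -/
def vert (v : TM E M) :
    TangentSpace 𝓘(ℝ, E) v.proj →L[ℝ] TangentSpace 𝓘(ℝ, E).tangent v :=
  mfderiv 𝓘(ℝ, E) 𝓘(ℝ, E).tangent (fun w : E => (⟨v.proj, w⟩ : TM E M)) v.2

/-- The canonical surjection `j`, fibrewise: the derivative of the projection `τ : TM → M`. -/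
def proj (v : TM E M) :
    TangentSpace 𝓘(ℝ, E).tangent v →L[ℝ] TangentSpace 𝓘(ℝ, E) v.proj :=
  mfderiv 𝓘(ℝ, E).tangent 𝓘(ℝ, E) (fun u : TM E M => u.proj) v

/-- The vertical vector field `i X` of a section `X`. -/
def vertField (X : Sec E M) : Field E M := fun v => vert v (X v)

/-- The section `j ξ` of a vector field `ξ`. -/
def projSec (ξ : Field E M) : Sec E M := fun v => proj v (ξ v)

/-- The vertical endomorphism `J = i ∘ j`. -/
def vertEnd (ξ : Field E M) : Field E M := vertField (projSec ξ)

/-! ### Finsler functions and the canonical spray -/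

/-- The vertical differential of a section: `(∇ᵛ_X Y)(v)` is the derivative at `v`, in the direction
`X v`, of the restriction of `Y` to the tangent space at `τ v`, a map of this vector space to
itself. It equals `j [i X, η]` for any vector field `η` with `j η = Y`: this is the fact
`proj_bracket_vertField` below. -/
def vDiffSec (X Y : Sec E M) : Sec E M :=
  fun v => fderiv ℝ (fun w : E => (Y ⟨v.proj, w⟩ : E)) v.2 (X v)

section VerticalDifferential

open Filter Set

theorem chart_incl (p : M) (w₀ w : E) :
    extChartAt 𝓘(ℝ, E).tangent (⟨p, w₀⟩ : TM E M) (⟨p, w⟩ : TM E M) = (extChartAt 𝓘(ℝ, E) p p, w) := by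
  refine Prod.ext rfl ?_
  show (tangentBundleCore 𝓘(ℝ, E) M).coordChange (achart E p) (achart E p) p w = w
  exact (tangentBundleCore 𝓘(ℝ, E) M).coordChange_self (achart E p) p (mem_chart_source E p) w

theorem chart_fst (v u : TM E M) :
    (extChartAt 𝓘(ℝ, E).tangent v u).1 = extChartAt 𝓘(ℝ, E) v.proj u.proj := rfl

theorem contMDiff_incl (p : M) :
    ContMDiff 𝓘(ℝ, E) 𝓘(ℝ, E).tangent ∞ (fun w : E => (⟨p, w⟩ : TM E M)) := by
  intro w
  rw [Bundle.contMDiffAt_totalSpace]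
  refine ⟨contMDiffAt_const, ?_⟩
  have : (fun x : E => (trivializationAt E (TangentSpace 𝓘(ℝ, E)) p (⟨p, x⟩ : TM E M)).2) = id := by
    funext x
    exact (tangentBundleCore 𝓘(ℝ, E) M).coordChange_self (achart E p) p (mem_chart_source E p) x
  exact this ▸ contMDiffAt_id

theorem proj_mdiff (v : TM E M) :
    MDifferentiableAt 𝓘(ℝ, E).tangent 𝓘(ℝ, E) (fun u : TM E M => u.proj) v :=
  (Bundle.contMDiff_proj (n := 1) (IB := 𝓘(ℝ, E)) (TangentSpace 𝓘(ℝ, E) : M → Type _)).mdifferentiableAt one_ne_zero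

theorem fst_mfderiv_chart (v u : TM E M) (hu : u ∈ (extChartAt 𝓘(ℝ, E).tangent v).source)
    (a : TangentSpace 𝓘(ℝ, E).tangent u) :
    ((mfderiv 𝓘(ℝ, E).tangent 𝓘(ℝ, E × E) (extChartAt 𝓘(ℝ, E).tangent v) u a : E × E)).1 =
      (mfderiv 𝓘(ℝ, E) 𝓘(ℝ, E) (extChartAt 𝓘(ℝ, E) v.proj) u.proj (proj u a) : E) := by
  have h1 : MDifferentiableAt 𝓘(ℝ, E).tangent 𝓘(ℝ, E × E) (extChartAt 𝓘(ℝ, E).tangent v) u :=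
    mdifferentiableAt_extChartAt (by simpa using hu)
  have h2 : MDifferentiableAt 𝓘(ℝ, E) 𝓘(ℝ, E) (extChartAt 𝓘(ℝ, E) v.proj) u.proj :=
    mdifferentiableAt_extChartAt (by simpa using hu)
  have h3 : HasMFDerivAt 𝓘(ℝ, E × E) 𝓘(ℝ, E) (Prod.fst : E × E → E)
      (extChartAt 𝓘(ℝ, E).tangent v u) (ContinuousLinearMap.fst ℝ E E) :=
    hasFDerivAt_fst.hasMFDerivAt
  have e1 := (h3.comp u h1.hasMFDerivAt).mfderiv
  have e2 := (h2.hasMFDerivAt.comp u (proj_mdiff u).hasMFDerivAt).mfderiv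
  have := e1.symm.trans e2
  exact DFunLike.congr_fun this a

theorem proj_vert (v : TM E M) (w : TangentSpace 𝓘(ℝ, E) v.proj) : proj v (vert v w) = 0 := by
  have h := ((proj_mdiff v).hasMFDerivAt.comp (x := v.2) (f := fun w : E => (⟨v.proj, w⟩ : TM E M))
    (((contMDiff_incl v.proj).mdifferentiableAt (by simp)).hasMFDerivAt)).mfderiv
  have h2 : mfderiv 𝓘(ℝ, E) 𝓘(ℝ, E) ((fun u : TM E M => u.proj) ∘ fun w : E => (⟨v.proj, w⟩ : TM E M)) v.2 = 0 :=
    mfderiv_const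
  exact DFunLike.congr_fun (h.symm.trans h2) w

theorem vert_apply (v : TM E M) (w : TangentSpace 𝓘(ℝ, E) v.proj) :
    (vert v w : E × E) = ((0 : E), (w : E)) := by
  have hi := (contMDiff_incl (E := E) v.proj |>.mdifferentiableAt (x := show E from v.2) (by simp)).hasMFDerivAt
  have hc : MDifferentiableAt 𝓘(ℝ, E).tangent 𝓘(ℝ, E × E) (extChartAt 𝓘(ℝ, E).tangent v) v :=
    mdifferentiableAt_extChartAt (by simp)
  have e1 := (hc.hasMFDerivAt.comp (x := show E from v.2) (f := fun w : E => (⟨v.proj, w⟩ : TM E M)) hi).mfderiv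
  have e2 : (extChartAt 𝓘(ℝ, E).tangent v ∘ fun w : E => (⟨v.proj, w⟩ : TM E M)) =
      fun w => (extChartAt 𝓘(ℝ, E) v.proj v.proj, w) := by
    funext w; exact chart_incl (E := E) v.proj v.2 w
  have e3 : HasMFDerivAt 𝓘(ℝ, E) 𝓘(ℝ, E × E) (fun w : E => (extChartAt 𝓘(ℝ, E) v.proj v.proj, w)) v.2
      (ContinuousLinearMap.inr ℝ E E) := by
    have := (hasFDerivAt_prodMk_right (𝕜 := ℝ) (E := E) (F := E) (extChartAt 𝓘(ℝ, E) v.proj v.proj) v.2)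
    exact this.hasMFDerivAt
  rw [e2, e3.mfderiv] at e1
  have e4 := DFunLike.congr_fun e1 w
  have e5 : mfderiv 𝓘(ℝ, E).tangent 𝓘(ℝ, E × E) (extChartAt 𝓘(ℝ, E).tangent v) v =
      ContinuousLinearMap.id ℝ _ := mfderiv_extChartAt_self
  rw [e5] at e4
  exact e4.symm

theorem pull_apply (v : TM E M) (η : Field E M) (z : E × E)
    (hz : z ∈ (extChartAt 𝓘(ℝ, E).tangent v).target) :
    (VectorField.mpullbackWithin 𝓘(ℝ, E × E) 𝓘(ℝ, E).tangent (extChartAt 𝓘(ℝ, E).tangent v).symm η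
      (range 𝓘(ℝ, E).tangent) z : E × E) =
    mfderiv 𝓘(ℝ, E).tangent 𝓘(ℝ, E × E) (extChartAt 𝓘(ℝ, E).tangent v)
      ((extChartAt 𝓘(ℝ, E).tangent v).symm z) (η ((extChartAt 𝓘(ℝ, E).tangent v).symm z)) := by
  rw [VectorField.mpullbackWithin_apply]
  have := ContinuousLinearMap.inverse_eq (mfderivWithin_extChartAt_symm_comp_mfderiv_extChartAt hz)
    (mfderiv_extChartAt_comp_mfderivWithin_extChartAt_symm hz)
  rw [this]
  rfl

/-- The vertical differential is also given by `∇ᵛ_X Y = j [i X, η]`, for any vector field `η` with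
`j η = Y`. -/
theorem proj_bracket_vertField [CompleteSpace E] (X : Sec E M) (η : Field E M) (v : TM E M)
    (hη : MDifferentiableAt 𝓘(ℝ, E).tangent 𝓘(ℝ, E).tangent.tangent (Field.toMap η) v) :
    projSec (bracket (vertField X) η) v = vDiffSec X (projSec η) v := by
  have hr : range (𝓘(ℝ, E).tangent) = univ := ModelWithCorners.Boundaryless.range_eq_univ
  set φ := extChartAt 𝓘(ℝ, E).tangent v with hφ
  set Xh : E × E → E × E := VectorField.mpullbackWithin 𝓘(ℝ, E × E) 𝓘(ℝ, E).tangent φ.symm (vertField X)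
      (range 𝓘(ℝ, E).tangent) with hXh
  set ηh : E × E → E × E := VectorField.mpullbackWithin 𝓘(ℝ, E × E) 𝓘(ℝ, E).tangent φ.symm η
      (range 𝓘(ℝ, E).tangent) with hηh
  have hb : (bracket (vertField X) η v : E × E) =
      fderiv ℝ ηh (φ v) (Xh (φ v)) - fderiv ℝ Xh (φ v) (ηh (φ v)) := by
    show VectorField.mlieBracketWithin _ _ _ univ v = _
    rw [VectorField.mlieBracketWithin_apply]
    have e5 : mfderiv 𝓘(ℝ, E).tangent 𝓘(ℝ, E × E) (extChartAt 𝓘(ℝ, E).tangent v) v =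
      ContinuousLinearMap.id ℝ _ := mfderiv_extChartAt_self
    erw [e5, ContinuousLinearMap.inverse_id]
    rw [hr]
    simp only [preimage_univ, univ_inter]
    have h0 := congrFun (VectorField.lieBracketWithin_univ (𝕜 := ℝ) (V := Xh) (W := ηh)) (φ v)
    rw [hXh, hηh, hr] at h0 ⊢
    exact h0
  have hproj : ∀ a : TangentSpace 𝓘(ℝ, E).tangent v, (proj v a : E) = (a : E × E).1 := by
    intro a
    have := fst_mfderiv_chart v v (mem_extChartAt_source v) a
    have e5 : mfderiv 𝓘(ℝ, E).tangent 𝓘(ℝ, E × E) (extChartAt 𝓘(ℝ, E).tangent v) v =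
      ContinuousLinearMap.id ℝ _ := mfderiv_extChartAt_self
    have e6 : mfderiv 𝓘(ℝ, E) 𝓘(ℝ, E) (extChartAt 𝓘(ℝ, E) v.proj) v.proj =
      ContinuousLinearMap.id ℝ _ := mfderiv_extChartAt_self
    rw [e5, e6] at this
    exact this.symm
  have htar : φ.target ∈ 𝓝 (φ v) := by
    have := extChartAt_target_mem_nhdsWithin (I := 𝓘(ℝ, E).tangent) v
    rwa [hr, nhdsWithin_univ] at this
  have hφv : φ.symm (φ v) = v := extChartAt_to_inv v
  have hXfst : (fun z => (Xh z).1) =ᶠ[𝓝 (φ v)] fun _ => 0 := by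
    filter_upwards [htar] with z hz
    rw [hXh, pull_apply v _ z hz, fst_mfderiv_chart v _ (φ.map_target hz)]
    show mfderiv 𝓘(ℝ, E) 𝓘(ℝ, E) _ _ (proj _ (vert _ _)) = 0
    rw [proj_vert, map_zero]
  have hXv : Xh (φ v) = ((0 : E), (X v : E)) := by
    rw [hXh, pull_apply v _ _ (mem_extChartAt_target v)]
    have : ∀ u, u = v → (mfderiv 𝓘(ℝ, E).tangent 𝓘(ℝ, E × E) φ u (vertField X u) : E × E) = ((0 : E), (X v : E)) := by
      rintro u rfl
      have e5 : mfderiv 𝓘(ℝ, E).tangent 𝓘(ℝ, E × E) φ u =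
        ContinuousLinearMap.id ℝ _ := mfderiv_extChartAt_self
      rw [e5]
      exact vert_apply u (X u)
    exact this _ hφv
  have hdη : DifferentiableAt ℝ ηh (φ v) := by
    have := MDifferentiableWithinAt.differentiableWithinAt_mpullbackWithin_vectorField
      (I := 𝓘(ℝ, E).tangent) (V := η) (s := univ) (x := v) hη.mdifferentiableWithinAt
    rw [hηh]
    rw [hr] at this ⊢
    rw [preimage_univ, univ_inter] at this
    exact this.differentiableAt univ_mem
  show (proj v (bracket (vertField X) η v) : E) = _
  rw [hproj, hb]
  have hz : (fderiv ℝ Xh (φ v) (ηh (φ v))).1 = 0 := by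
    by_cases hd : DifferentiableAt ℝ Xh (φ v)
    · have h1 := (hasFDerivAt_fst.comp (φ v) hd.hasFDerivAt).fderiv
      have h2 : fderiv ℝ (Prod.fst ∘ Xh) (φ v) = 0 := by
        exact (Filter.EventuallyEq.fderiv_eq (f₁ := Prod.fst ∘ Xh) hXfst).trans (by simp)
      rw [h2] at h1
      exact (DFunLike.congr_fun h1 (ηh (φ v))).symm
    · rw [fderiv_zero_of_not_differentiableAt hd]; rfl
  set w₀ : E := v.2 with hw₀
  rw [Prod.fst_sub, hz, sub_zero, hXv]
  have hφv' : φ v = (extChartAt 𝓘(ℝ, E) v.proj v.proj, w₀) := chart_incl (E := E) v.proj v.2 v.2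
  have hin : HasFDerivAt (E := E) (𝕜 := ℝ) (F := E × E) (fun w : E => (extChartAt 𝓘(ℝ, E) v.proj v.proj, w))
      (ContinuousLinearMap.inr ℝ E E) w₀ := hasFDerivAt_prodMk_right _ _
  have hcomp : HasFDerivAt (E := E) (𝕜 := ℝ) (F := E) (fun w : E => (ηh (extChartAt 𝓘(ℝ, E) v.proj v.proj, w)).1)
      ((ContinuousLinearMap.fst ℝ E E).comp ((fderiv ℝ ηh (φ v)).comp (ContinuousLinearMap.inr ℝ E E)))
      w₀ := by
    have h := hdη.hasFDerivAt
    rw [hφv'] at h ⊢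
    exact hasFDerivAt_fst.comp _ (h.comp _ hin)
  have hfun : (fun w : E => (ηh (extChartAt 𝓘(ℝ, E) v.proj v.proj, w)).1) =
      fun w : E => (projSec η ⟨v.proj, w⟩ : E) := by
    funext w
    have hs : (⟨v.proj, w⟩ : TM E M) ∈ φ.source := by simp [hφ]
    have hw : φ ⟨v.proj, w⟩ = (extChartAt 𝓘(ℝ, E) v.proj v.proj, w) := chart_incl (E := E) v.proj v.2 w
    rw [← hw, hηh, pull_apply v _ _ (φ.map_source hs), fst_mfderiv_chart v _ (φ.map_target (φ.map_source hs))]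
    have : ∀ u : TM E M, u = ⟨v.proj, w⟩ → (mfderiv 𝓘(ℝ, E) 𝓘(ℝ, E) (extChartAt 𝓘(ℝ, E) v.proj) u.proj (proj u (η u)) : E) = projSec η ⟨v.proj, w⟩ := by
      rintro u rfl
      have e6 : mfderiv 𝓘(ℝ, E) 𝓘(ℝ, E) (extChartAt 𝓘(ℝ, E) v.proj) v.proj =
        ContinuousLinearMap.id ℝ _ := mfderiv_extChartAt_self
      exact DFunLike.congr_fun e6 _
    exact this _ (φ.left_inv hs)
  rw [vDiffSec, ← hfun, hcomp.fderiv]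
  rfl

end VerticalDifferential

/-- The vertical differential of a function, `∇ᵛ f (X) = (i X) f`. -/
def vDiffFun (f : TM E M → ℝ) (X : Sec E M) : TM E M → ℝ := applyField (vertField X) f

/-- The metric tensor `g = ½ ∇ᵛ ∇ᵛ F²`. -/
def metric (F : TM E M → ℝ) (X Y : Sec E M) : TM E M → ℝ := fun v =>
  (1 / 2) * (applyField (vertField X) (vDiffFun (fun u => F u ^ 2) Y) v
    - vDiffFun (fun u => F u ^ 2) (vDiffSec X Y) v)

/-- Finsler functions: smooth on the slit tangent manifold, positive-homogeneous of degree one, and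
with fibrewise nondegenerate metric tensor. -/
structure IsFinslerFunction (F : TM E M → ℝ) : Prop where
  smooth : ContMDiffOn 𝓘(ℝ, E).tangent 𝓘(ℝ, ℝ) ∞ F (slit E M)
  homogeneous : ∀ (p : M) (w : TangentSpace 𝓘(ℝ, E) p) (c : ℝ), 0 ≤ c →
    F (⟨p, c • w⟩ : TM E M) = c * F (⟨p, w⟩ : TM E M)
  nondegenerate : ∀ v ∈ slit E M, ∀ X : Sec E M, SmoothSec X →
    (∀ Y : Sec E M, SmoothSec Y → metric F X Y v = 0) → X v = 0

/-- The energy function `E = ½ F²`. -/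
def energy (F : TM E M → ℝ) : TM E M → ℝ := fun v => (1 / 2) * F v ^ 2

/-- The one-form `d_J f = df ∘ J`, evaluated on a vector field. -/
def dJ (f : TM E M → ℝ) (ξ : Field E M) : TM E M → ℝ := applyField (vertEnd ξ) f

/-- The two-form `d d_J f`, evaluated on vector fields:
`dα(ξ, η) = ξ (α η) - η (α ξ) - α [ξ, η]` for the one-form `α = d_J f`. -/
def ddJ (f : TM E M → ℝ) (ξ η : Field E M) : TM E M → ℝ := fun v =>
  applyField ξ (dJ f η) v - applyField η (dJ f ξ) v - dJ f (bracket ξ η) v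

/-- `S` is the canonical spray of `F`: zero on the zero vectors and, over the slit tangent manifold,
the smooth vector field with `i_S d d_J E = - dE`. The equation is tested at each point on all
vector fields that are smooth at this point. -/
structure IsCanonicalSpray (F : TM E M → ℝ) (S : Field E M) : Prop where
  zero : ∀ v : TM E M, v ∉ slit E M → S v = 0
  smooth : SmoothField S
  eq : ∀ v ∈ slit E M, ∀ ξ : Field E M,
    ContMDiffAt 𝓘(ℝ, E).tangent 𝓘(ℝ, E).tangent.tangent ∞ (Field.toMap ξ) v →
    ddJ (energy F) S ξ v = - applyField ξ (energy F) v

/-- The canonical spray of a Finsler function (the unique vector field with the property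
`IsCanonicalSpray`). -/
def canonicalSpray (F : TM E M → ℝ) : Field E M :=
  Classical.epsilon fun S => IsCanonicalSpray F S

/-! ### Ehresmann connections and the canonical connection -/

variable (E M) in
/-- Fibre preserving and fibrewise linear maps `TM ×_M TM → TTM`. -/
abbrev Conn := (v : TM E M) → TangentSpace 𝓘(ℝ, E) v.proj →L[ℝ] TangentSpace 𝓘(ℝ, E).tangent v

/-- The horizontal vector field `H X` of a section `X`. -/
def horField (H : Conn E M) (X : Sec E M) : Field E M := fun v => H v (X v)

/-- Ehresmann connections: fibrewise linear splittings of `j`, smooth over the slit tangent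
manifold, given on the zero vectors by the derivative of the zero vector field. -/
structure IsEhresmannConnection (H : Conn E M) : Prop where
  splits : ∀ (v : TM E M) (w : TangentSpace 𝓘(ℝ, E) v.proj), proj v (H v w) = w
  smooth : ∀ X : Sec E M, SmoothSec X → SmoothField (horField H X)
  zero : ∀ (p : M) (w : TangentSpace 𝓘(ℝ, E) p),
    H (⟨p, 0⟩ : TM E M) w =
      mfderiv 𝓘(ℝ, E) 𝓘(ℝ, E).tangent (fun q : M => (⟨q, 0⟩ : TM E M)) p w

/-- The complete lift of a function on `M`: `fᶜ(v) = v(f)`. -/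
def completeLiftFun (f : M → ℝ) : TM E M → ℝ :=
  fun v => (mfderiv 𝓘(ℝ, E) 𝓘(ℝ, ℝ) f v.proj v.2 : ℝ)

/-- `ξ` is the complete lift of the vector field `X` on `M`: the smooth vector field on `TM` with
`ξ fᶜ = (X f)ᶜ` for all smooth functions `f` (tested at each `v` on the functions that are smooth at
`τ v`). -/
structure IsCompleteLift (X : (p : M) → TangentSpace 𝓘(ℝ, E) p) (ξ : Field E M) : Prop where
  smooth : ContMDiff 𝓘(ℝ, E).tangent 𝓘(ℝ, E).tangent.tangent ∞ (Field.toMap ξ)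
  eq : ∀ (v : TM E M) (f : M → ℝ), ContMDiffAt 𝓘(ℝ, E) 𝓘(ℝ, ℝ) ∞ f v.proj →
    applyField ξ (completeLiftFun f) v =
      completeLiftFun (fun p => (mfderiv 𝓘(ℝ, E) 𝓘(ℝ, ℝ) f p (X p) : ℝ)) v

/-- `H` is the Ehresmann connection generated by the semispray `S`:
`H(X̂) = ½ (Xᶜ + [Xᵛ, S])` over the slit tangent manifold for all vector fields `X` on `M`, where
`Xᵛ = i X̂` and `Xᶜ` are the vertical and the complete lift of `X`. -/
structure IsGeneratedBy (S : Field E M) (H : Conn E M) : Prop where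
  isEhresmann : IsEhresmannConnection H
  eq : ∀ X : (p : M) → TangentSpace 𝓘(ℝ, E) p, SmoothVectorField X →
    ∀ Xc : Field E M, IsCompleteLift X Xc → ∀ v ∈ slit E M,
      horField H (basic X) v = (1 / 2 : ℝ) • (Xc v + bracket (vertField (basic X)) S v)

/-- The canonical connection of a Finsler function: the (unique) Ehresmann connection generated by
the canonical spray. -/
def canonicalConnection (F : TM E M → ℝ) : Conn E M :=
  Classical.epsilon fun H => IsGeneratedBy (canonicalSpray F) H

/-! ### The Berwald derivative of an Ehresmann connection and its affine curvature -/

/-- The vertical map `V = i⁻¹ ∘ (1 - H ∘ j)`; note that `1 - H ∘ j` takes values in the image of the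
injection `i`. -/
def vertMap (H : Conn E M) (ξ : Field E M) : Sec E M :=
  fun v => Function.invFun (vert v) (ξ v - H v (proj v (ξ v)))

/-- The horizontal differential of a section, `∇ʰ_X Y = V [H X, i Y]`. -/
def hDiffSec (H : Conn E M) (X Y : Sec E M) : Sec E M :=
  vertMap H (bracket (horField H X) (vertField Y))

/-- The Berwald derivative `∇_ξ Y = ∇ᵛ_{V ξ} Y + ∇ʰ_{j ξ} Y`. -/
def berwald (H : Conn E M) (ξ : Field E M) (Y : Sec E M) : Sec E M :=
  vDiffSec (vertMap H ξ) Y + hDiffSec H (projSec ξ) Y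

/-- The curvature of the Berwald derivative,
`R(ξ, η) Z = ∇_ξ ∇_η Z - ∇_η ∇_ξ Z - ∇_{[ξ, η]} Z`. -/
def berwaldCurvature (H : Conn E M) (ξ η : Field E M) (Z : Sec E M) : Sec E M :=
  berwald H ξ (berwald H η Z) - berwald H η (berwald H ξ Z) - berwald H (bracket ξ η) Z

/-- The affine curvature `𝐇(X, Y) Z = R(H X, H Y) Z` of an Ehresmann connection. -/
def affineCurvature (H : Conn E M) (X Y Z : Sec E M) : Sec E M :=
  berwaldCurvature H (horField H X) (horField H Y) Z

/-- The vertical differential of the affine curvature,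
`∇ᵛ𝐇(X, Y, Z, U) = (∇ᵛ_X 𝐇)(Y, Z) U`. -/
def vDiffAffineCurvature (H : Conn E M) (X Y Z U : Sec E M) : Sec E M :=
  vDiffSec X (affineCurvature H Y Z U) - affineCurvature H (vDiffSec X Y) Z U
    - affineCurvature H Y (vDiffSec X Z) U - affineCurvature H Y Z (vDiffSec X U)

/-- An Ehresmann connection is R-quadratic if the vertical differential of its affine curvature
vanishes. -/
def IsRQuadratic (H : Conn E M) : Prop :=
  ∀ X Y Z U : Sec E M, SmoothSec X → SmoothSec Y → SmoothSec Z → SmoothSec U →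
    ∀ v ∈ slit E M, vDiffAffineCurvature H X Y Z U v = 0

/-! ### The Landsberg tensor and the stretch tensor -/

/-- The Landsberg tensor `P = -½ ∇ʰ g`, where `∇ʰ g (X, Y, Z) = (∇ʰ_X g)(Y, Z)` is formed with
respect to the canonical connection. -/
def landsberg (F : TM E M → ℝ) (X Y Z : Sec E M) : TM E M → ℝ := fun v =>
  -(1 / 2) * (applyField (horField (canonicalConnection F) X) (metric F Y Z) v
    - metric F (hDiffSec (canonicalConnection F) X Y) Z v
    - metric F Y (hDiffSec (canonicalConnection F) X Z) v)

/-- The horizontal differential of the Landsberg tensor, `∇ʰP(X, Y, Z, U) = (∇ʰ_X P)(Y, Z, U)`. -/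
def hDiffLandsberg (F : TM E M → ℝ) (X Y Z U : Sec E M) : TM E M → ℝ := fun v =>
  applyField (horField (canonicalConnection F) X) (landsberg F Y Z U) v
    - landsberg F (hDiffSec (canonicalConnection F) X Y) Z U v
    - landsberg F Y (hDiffSec (canonicalConnection F) X Z) U v
    - landsberg F Y Z (hDiffSec (canonicalConnection F) X U) v

/-- The stretch tensor, `½ Σ(X, Y, Z, U) = ∇ʰP(X, Y, Z, U) - ∇ʰP(Y, X, Z, U)`. -/
def stretch (F : TM E M → ℝ) (X Y Z U : Sec E M) : TM E M → ℝ := fun v =>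
  2 * (hDiffLandsberg F X Y Z U v - hDiffLandsberg F Y X Z U v)

end

end Finsler

end

open scoped Manifold ContDiff Topology

noncomputable section

namespace Finsler

open Set Filter

/-! ### The tangent manifold in charts: functions, sections, vector fields and the canonical
operations. -/

section Coordinates

variable {E : Type*} [NormedAddCommGroup E] [NormedSpace ℝ E]
  {M : Type*} [TopologicalSpace M] [ChartedSpace E M] [IsManifold 𝓘(ℝ, E) ∞ M]

/-! The identity is checked at each nonzero vector in a chart with coordinates (x, y). Let a prime
denote differentiation in y (`vd`). The canonical spray is (y, -2G), horizontal lifts are (a, -G'a)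
(`hor`), the Berwald derivative along ξ is the coordinate derivative along ξ plus the Christoffel
symbols Γ = G'' applied to the base component of ξ, and the Berwald tensor is B = G'''. Write θ =
∇ᵛE, with coordinates `vd f`.

Three facts carry the proof. (1) A Bianchi-type identity, valid for any G (`vd_curv`): since mixed
derivatives commute, ∇ᵛ𝐇(X, Y, Z, U) = ∇ʰB(Y, X, Z, U) - ∇ʰB(Z, X, Y, U). (2) The energy is constant
along horizontal directions (`IsSprayData.conservative`), by the spray equation and Euler's
relation. One vertical derivative of this gives ∇ʰθ = 0 (`IsSprayData.fderiv_vd_hor`), and a second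
one gives ∇ʰg = θ∘B (`IsSprayData.fderiv_metric_hor`). So P = -½ θ∘B. (3) As θ is horizontally
parallel, ∇ʰP = -½ θ(∇ʰB) (`IsSprayData.hDiff_landsberg`).

Applying θ to (1) and using the total symmetry of B turns the right side into the alternation of ∇ʰP
that defines Σ.

The spray and the connection are introduced by a choice operator, so the properties just used
require existence proofs. These define both objects pointwise, each vector using its own chart. For
the spray, independence of the chart comes from the invariance of its equation and the uniqueness of
the solution, which rests on nondegeneracy of g. For the connection it comes from the generating
formula applied to complete lifts. -/

/-- The chart of the tangent manifold around `v₀`, with values in `E × E`. -/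
abbrev tchart (v₀ : TM E M) : PartialEquiv (TM E M) (E × E) := extChartAt 𝓘(ℝ, E).tangent v₀

/-- The derivative of the chart of `M` around `v₀.proj`, at the point `q`. -/
def fibreMap (v₀ : TM E M) (q : M) : TangentSpace 𝓘(ℝ, E) q →L[ℝ] E :=
  mfderiv 𝓘(ℝ, E) 𝓘(ℝ, E) (extChartAt 𝓘(ℝ, E) v₀.proj) q

/-- The derivative of the chart of the tangent manifold around `v₀`, at the point `u`. -/
def tfibreMap (v₀ u : TM E M) : TangentSpace 𝓘(ℝ, E).tangent u →L[ℝ] E × E :=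
  mfderiv 𝓘(ℝ, E).tangent 𝓘(ℝ, E × E) (tchart v₀) u

/-- A function on the tangent manifold in coordinates. -/
def funRep (v₀ : TM E M) (f : TM E M → ℝ) (z : E × E) : ℝ := f ((tchart v₀).symm z)

/-- A section in coordinates. -/
def secRep (v₀ : TM E M) (X : Sec E M) (z : E × E) : E :=
  fibreMap v₀ ((tchart v₀).symm z).proj (X ((tchart v₀).symm z))

/-- A vector field on the tangent manifold in coordinates. -/
def fieldRep (v₀ : TM E M) (ξ : Field E M) (z : E × E) : E × E :=
  tfibreMap v₀ ((tchart v₀).symm z) (ξ ((tchart v₀).symm z))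

/-- The part of the coordinate domain that corresponds to the slit tangent manifold. -/
def dom (v₀ : TM E M) : Set (E × E) := {z | z ∈ (tchart v₀).target ∧ z.2 ≠ 0}

theorem isOpen_tchart_target (v₀ : TM E M) : IsOpen (tchart v₀).target :=
  isOpen_extChartAt_target v₀

theorem isOpen_dom (v₀ : TM E M) : IsOpen (dom v₀) :=
  (isOpen_tchart_target v₀).inter (isOpen_ne.preimage continuous_snd)

theorem mem_tchart_source {v₀ u : TM E M} :
    u ∈ (tchart v₀).source ↔ u.proj ∈ (extChartAt 𝓘(ℝ, E) v₀.proj).source := by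
  simp [tchart]

theorem mem_tchart_target {v₀ : TM E M} {z : E × E} :
    z ∈ (tchart v₀).target ↔ z.1 ∈ (extChartAt 𝓘(ℝ, E) v₀.proj).target := by
  simp only [tchart, mfld_simps]
  exact TangentBundle.mem_chart_target_iff _ _

/-- The fibre part of the chart is the trivialization of the tangent bundle, which is the derivative
of the base chart. Hence the chart is linear on each fibre, with the very map that `secRep` applies
to sections. -/
theorem tchart_apply {v₀ : TM E M} {q : M} (hq : q ∈ (extChartAt 𝓘(ℝ, E) v₀.proj).source)
    (w : TangentSpace 𝓘(ℝ, E) q) :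
    tchart v₀ (⟨q, w⟩ : TM E M) = (extChartAt 𝓘(ℝ, E) v₀.proj q, fibreMap v₀ q w) := by
  refine Prod.ext rfl ?_
  have h := TangentBundle.continuousLinearMapAt_trivializationAt (I := 𝓘(ℝ, E)) (x₀ := v₀.proj)
    (x := q) (by simpa using hq)
  have h2 := DFunLike.congr_fun h w
  rw [Bundle.Trivialization.continuousLinearMapAt_apply, Bundle.Trivialization.linearMapAt_apply,
    if_pos (by simpa using hq)] at h2
  exact h2

theorem fibreMap_isInvertible {v₀ : TM E M} {q : M}
    (hq : q ∈ (extChartAt 𝓘(ℝ, E) v₀.proj).source) : (fibreMap v₀ q).IsInvertible :=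
  isInvertible_mfderiv_extChartAt hq

theorem tfibreMap_isInvertible {v₀ u : TM E M} (hu : u ∈ (tchart v₀).source) :
    (tfibreMap v₀ u).IsInvertible :=
  isInvertible_mfderiv_extChartAt hu

/-- Each tangent space is modelled on the preferred chart at its point, so at `v` the coordinates in
the chart around `v` are the vectors themselves. This lets objects be defined pointwise by
coordinate formulas. -/
theorem fibreMap_self (v : TM E M) : fibreMap v v.proj = ContinuousLinearMap.id ℝ E :=
  mfderiv_extChartAt_self

theorem tfibreMap_self (v : TM E M) : tfibreMap v v = ContinuousLinearMap.id ℝ (E × E) :=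
  mfderiv_extChartAt_self

theorem fibreMap_injective {v₀ : TM E M} {q : M}
    (hq : q ∈ (extChartAt 𝓘(ℝ, E) v₀.proj).source) : Function.Injective (fibreMap v₀ q) := by
  obtain ⟨e, he⟩ := fibreMap_isInvertible hq
  rw [← he]; exact e.injective

theorem tfibreMap_injective {v₀ u : TM E M} (hu : u ∈ (tchart v₀).source) :
    Function.Injective (tfibreMap v₀ u) := by
  obtain ⟨e, he⟩ := tfibreMap_isInvertible hu
  rw [← he]; exact e.injective

theorem tchart_symm_mem {v₀ : TM E M} {z : E × E} (hz : z ∈ (tchart v₀).target) :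
    ((tchart v₀).symm z).proj ∈ (extChartAt 𝓘(ℝ, E) v₀.proj).source :=
  mem_tchart_source.1 ((tchart v₀).map_target hz)

theorem tchart_symm_coords {v₀ : TM E M} {z : E × E} (hz : z ∈ (tchart v₀).target) :
    extChartAt 𝓘(ℝ, E) v₀.proj ((tchart v₀).symm z).proj = z.1 ∧
      fibreMap v₀ ((tchart v₀).symm z).proj ((tchart v₀).symm z).2 = z.2 := by
  have h := tchart_apply (tchart_symm_mem hz) ((tchart v₀).symm z).2
  have h2 : tchart v₀ ((tchart v₀).symm z) = z := (tchart v₀).right_inv hz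
  have h3 := h2.symm.trans h
  exact ⟨(congrArg Prod.fst h3).symm, (congrArg Prod.snd h3).symm⟩

theorem tchart_symm_mem_slit {v₀ : TM E M} {z : E × E} (hz : z ∈ dom v₀) :
    (tchart v₀).symm z ∈ slit E M := by
  intro h
  apply hz.2
  rw [← (tchart_symm_coords hz.1).2, h]
  exact map_zero _

theorem tchart_mem_dom {v₀ u : TM E M} (hu : u ∈ (tchart v₀).source) (hs : u ∈ slit E M) :
    tchart v₀ u ∈ dom v₀ := by
  refine ⟨(tchart v₀).map_source hu, fun h => hs ?_⟩
  have h1 := tchart_apply (mem_tchart_source.1 hu) u.2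
  apply fibreMap_injective (mem_tchart_source.1 hu)
  exact (congrArg Prod.snd h1).symm.trans (h.trans (map_zero _).symm)

theorem tchart_self_mem_dom {v : TM E M} (hv : v ∈ slit E M) : tchart v v ∈ dom v :=
  tchart_mem_dom (mem_extChartAt_source v) hv

theorem contMDiffAt_tchart {v₀ u : TM E M} (hu : u ∈ (tchart v₀).source) :
    ContMDiffAt 𝓘(ℝ, E).tangent 𝓘(ℝ, E × E) ∞ (tchart v₀) u :=
  contMDiffAt_extChartAt' (by simpa using hu)

theorem contMDiffAt_tchart_symm {v₀ : TM E M} {z : E × E} (hz : z ∈ (tchart v₀).target) :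
    ContMDiffAt 𝓘(ℝ, E × E) 𝓘(ℝ, E).tangent ∞ (tchart v₀).symm z :=
  (contMDiffOn_extChartAt_symm v₀).contMDiffAt ((isOpen_tchart_target v₀).mem_nhds hz)

theorem eventually_mem_target {v₀ : TM E M} {z : E × E} (hz : z ∈ (tchart v₀).target) :
    ∀ᶠ z' in 𝓝 z, z' ∈ (tchart v₀).target := (isOpen_tchart_target v₀).mem_nhds hz

theorem eventually_mem_source {v₀ u : TM E M} (hu : u ∈ (tchart v₀).source) :
    ∀ᶠ u' in 𝓝 u, u' ∈ (tchart v₀).source := (isOpen_extChartAt_source v₀).mem_nhds hu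

theorem funRep_tchart {v₀ u : TM E M} (hu : u ∈ (tchart v₀).source) (f : TM E M → ℝ) :
    funRep v₀ f (tchart v₀ u) = f u := congrArg f ((tchart v₀).left_inv hu)

theorem secRep_tchart {v₀ u : TM E M} (hu : u ∈ (tchart v₀).source) (X : Sec E M) :
    secRep v₀ X (tchart v₀ u) = fibreMap v₀ u.proj (X u) := by
  rw [secRep, (tchart v₀).left_inv hu]

theorem fieldRep_tchart {v₀ u : TM E M} (hu : u ∈ (tchart v₀).source) (ξ : Field E M) :
    fieldRep v₀ ξ (tchart v₀ u) = tfibreMap v₀ u (ξ u) := by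
  rw [fieldRep, (tchart v₀).left_inv hu]

theorem secRep_self (X : Sec E M) (v : TM E M) : secRep v X (tchart v v) = X v := by
  rw [secRep_tchart (mem_extChartAt_source v), fibreMap_self]; rfl

theorem fieldRep_self (ξ : Field E M) (v : TM E M) : fieldRep v ξ (tchart v v) = ξ v := by
  rw [fieldRep_tchart (mem_extChartAt_source v), tfibreMap_self]; rfl

theorem tchart_symm_isInvertible {v₀ : TM E M} {z : E × E} (hz : z ∈ (tchart v₀).target) :
    (mfderiv 𝓘(ℝ, E × E) 𝓘(ℝ, E).tangent (tchart v₀).symm z).IsInvertible := by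
  have hr : range (𝓘(ℝ, E).tangent) = univ := ModelWithCorners.Boundaryless.range_eq_univ
  have := isInvertible_mfderivWithin_extChartAt_symm hz
  rwa [hr, mfderivWithin_univ] at this

/-- Coordinates are pullback along the inverse chart; smoothness of pullbacks and naturality of the
Lie bracket thereby become available. -/
theorem fieldRep_eq_mpullback {v₀ : TM E M} {z : E × E} (hz : z ∈ (tchart v₀).target)
    (ξ : Field E M) :
    fieldRep v₀ ξ z =
      VectorField.mpullback 𝓘(ℝ, E × E) 𝓘(ℝ, E).tangent (tchart v₀).symm ξ z := by
  have hr : range (𝓘(ℝ, E).tangent) = univ := ModelWithCorners.Boundaryless.range_eq_univ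
  have := pull_apply v₀ ξ z hz
  rw [hr, VectorField.mpullbackWithin_univ] at this
  exact this.symm

theorem mpullback_fieldRep {v₀ u : TM E M} (hu : u ∈ (tchart v₀).source) (ξ : Field E M) :
    VectorField.mpullback 𝓘(ℝ, E).tangent 𝓘(ℝ, E × E) (tchart v₀)
      (fun z => (fieldRep v₀ ξ z : TangentSpace 𝓘(ℝ, E × E) z)) u = ξ u := by
  have h := fieldRep_tchart hu ξ
  obtain ⟨e, he⟩ := tfibreMap_isInvertible hu
  apply tfibreMap_injective hu
  rw [← h]
  show tfibreMap v₀ u ((tfibreMap v₀ u).inverse _) = _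
  rw [← he, ContinuousLinearMap.inverse_equiv]
  exact e.apply_symm_apply _

/-! ### Smoothness in coordinates -/

theorem contMDiffAt_toMap_of_fieldRep [CompleteSpace E] {v₀ u : TM E M}
    (hu : u ∈ (tchart v₀).source) (ξ : Field E M)
    (h : ContDiffAt ℝ ∞ (fieldRep v₀ ξ) (tchart v₀ u)) :
    ContMDiffAt 𝓘(ℝ, E).tangent 𝓘(ℝ, E).tangent.tangent ∞ (Field.toMap ξ) u := by
  have h1 := ContMDiffAt.mpullback_vectorField_preimage (I := 𝓘(ℝ, E).tangent)
    (n := ∞) (m := ∞) (f := tchart v₀) (x₀ := u)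
    (V := fun z => (fieldRep v₀ ξ z : TangentSpace 𝓘(ℝ, E × E) z))
    (contMDiffAt_vectorSpace_iff_contDiffAt.2 h) (contMDiffAt_tchart hu)
    (tfibreMap_isInvertible hu) (by simp)
  refine h1.congr_of_eventuallyEq ?_
  filter_upwards [eventually_mem_source hu] with u' hu'
  rw [mpullback_fieldRep hu']
  rfl

theorem contDiffAt_fieldRep [CompleteSpace E] {v₀ u : TM E M}
    (hu : u ∈ (tchart v₀).source) (ξ : Field E M)
    (h : ContMDiffAt 𝓘(ℝ, E).tangent 𝓘(ℝ, E).tangent.tangent ∞ (Field.toMap ξ) u) :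
    ContDiffAt ℝ ∞ (fieldRep v₀ ξ) (tchart v₀ u) := by
  have hz := (tchart v₀).map_source hu
  have hl := (tchart v₀).left_inv hu
  have h1 := ContMDiffAt.mpullback_vectorField_preimage (I' := 𝓘(ℝ, E).tangent)
    (n := ∞) (m := ∞) (f := (tchart v₀).symm) (x₀ := tchart v₀ u) (V := ξ)
    (by rw [hl]; exact h) (contMDiffAt_tchart_symm hz) 
    (tchart_symm_isInvertible hz) (by simp)
  refine contMDiffAt_vectorSpace_iff_contDiffAt.1 (h1.congr_of_eventuallyEq ?_)
  filter_upwards [eventually_mem_target hz] with z' hz'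
  rw [fieldRep_eq_mpullback hz']

theorem smoothField_of_fieldRep [CompleteSpace E] (ξ : Field E M)
    (h : ∀ v ∈ slit E M, ContDiffAt ℝ ∞ (fieldRep v ξ) (tchart v v)) : SmoothField ξ := fun v hv =>
  (contMDiffAt_toMap_of_fieldRep (mem_extChartAt_source v) ξ (h v hv)).contMDiffWithinAt

theorem isOpen_slit : IsOpen (slit E M) := by
  rw [isOpen_iff_mem_nhds]
  intro v hv
  have h := (continuousAt_extChartAt (I := 𝓘(ℝ, E).tangent) v).preimage_mem_nhds
    ((isOpen_dom v).mem_nhds (tchart_self_mem_dom hv))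
  filter_upwards [h, eventually_mem_source (mem_extChartAt_source v)] with u hu hs
  have := tchart_symm_mem_slit hu
  rwa [(tchart v).left_inv hs] at this

theorem contDiffAt_fieldRep_of_smoothField [CompleteSpace E] {v₀ : TM E M} {z : E × E}
    (hz : z ∈ dom v₀) {ξ : Field E M} (h : SmoothField ξ) : ContDiffAt ℝ ∞ (fieldRep v₀ ξ) z := by
  have := contDiffAt_fieldRep ((tchart v₀).map_target hz.1) ξ
    (ContMDiffOn.contMDiffAt h (isOpen_slit.mem_nhds (tchart_symm_mem_slit hz)))
  rwa [(tchart v₀).right_inv hz.1] at this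

theorem contDiffAt_secRep {v₀ : TM E M} {z : E × E} (hz : z ∈ (tchart v₀).target) (X : Sec E M)
    (h : ContMDiffAt 𝓘(ℝ, E).tangent 𝓘(ℝ, E).tangent ∞ (fun v => (⟨v.proj, X v⟩ : TM E M))
      ((tchart v₀).symm z)) : ContDiffAt ℝ ∞ (secRep v₀ X) z := by
  have hs := tchart_symm_mem hz
  have h1 : ContMDiffAt 𝓘(ℝ, E × E) 𝓘(ℝ, E × E) ∞
      (tchart v₀ ∘ (fun v => (⟨v.proj, X v⟩ : TM E M)) ∘ (tchart v₀).symm) z := by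
    refine ContMDiffAt.comp z (contMDiffAt_tchart ?_) (h.comp z (contMDiffAt_tchart_symm hz))
    exact mem_tchart_source.2 hs
  have h2 := (contMDiffAt_iff_contDiffAt.1 h1).snd
  refine h2.congr_of_eventuallyEq ?_
  filter_upwards [eventually_mem_target hz] with z' hz'
  simp only [Function.comp_apply]
  rw [tchart_apply (tchart_symm_mem hz')]
  rfl

theorem contDiffAt_secRep_of_smoothSec {v₀ : TM E M} {z : E × E} (hz : z ∈ dom v₀) {X : Sec E M}
    (h : SmoothSec X) : ContDiffAt ℝ ∞ (secRep v₀ X) z :=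
  contDiffAt_secRep hz.1 X
    (ContMDiffOn.contMDiffAt h (isOpen_slit.mem_nhds (tchart_symm_mem_slit hz)))

theorem smoothSec_of_secRep (X : Sec E M)
    (h : ∀ v ∈ slit E M, ContDiffAt ℝ ∞ (secRep v X) (tchart v v)) : SmoothSec X := by
  intro v hv
  refine ContMDiffAt.contMDiffWithinAt ?_
  rw [Bundle.contMDiffAt_totalSpace]
  refine ⟨(Bundle.contMDiff_proj (IB := 𝓘(ℝ, E)) (TangentSpace 𝓘(ℝ, E) : M → Type _)).contMDiffAt,
    ?_⟩
  have h1 := (contMDiffAt_iff_contDiffAt.2 (h v hv)).comp v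
    (contMDiffAt_tchart (mem_extChartAt_source v))
  refine h1.congr_of_eventuallyEq ?_
  filter_upwards [eventually_mem_source (mem_extChartAt_source v)] with u hu
  rw [Function.comp_apply, secRep_tchart hu]
  exact congrArg Prod.snd (tchart_apply (mem_tchart_source.1 hu) (X u))

theorem contDiffAt_funRep {v₀ : TM E M} {z : E × E} (hz : z ∈ (tchart v₀).target)
    {f : TM E M → ℝ} (h : ContMDiffAt 𝓘(ℝ, E).tangent 𝓘(ℝ, ℝ) ∞ f ((tchart v₀).symm z)) :
    ContDiffAt ℝ ∞ (funRep v₀ f) z :=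
  contMDiffAt_iff_contDiffAt.1 (h.comp z (contMDiffAt_tchart_symm hz))

/-! ### The canonical operations in coordinates -/

theorem funRep_applyField {v₀ : TM E M} {z : E × E} (hz : z ∈ (tchart v₀).target)
    (ξ : Field E M) {f : TM E M → ℝ} (h : DifferentiableAt ℝ (funRep v₀ f) z) :
    funRep v₀ (applyField ξ f) z = fderiv ℝ (funRep v₀ f) z (fieldRep v₀ ξ z) := by
  set u := (tchart v₀).symm z with hu
  have hus : u ∈ (tchart v₀).source := (tchart v₀).map_target hz
  have hzu : tchart v₀ u = z := (tchart v₀).right_inv hz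
  have h1 : HasMFDerivAt 𝓘(ℝ, E × E) 𝓘(ℝ, ℝ) (funRep v₀ f) (tchart v₀ u)
      (fderiv ℝ (funRep v₀ f) z) := by
    rw [hzu]; exact h.hasFDerivAt.hasMFDerivAt
  have h2 := h1.comp u ((contMDiffAt_tchart hus).mdifferentiableAt (by simp)).hasMFDerivAt
  have h3 : funRep v₀ f ∘ tchart v₀ =ᶠ[𝓝 u] f := by
    filter_upwards [eventually_mem_source hus] with u' hu' using funRep_tchart hu' f
  have h4 := (h2.congr_of_eventuallyEq h3.symm).mfderiv
  exact DFunLike.congr_fun h4 (ξ u)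

/-- The bracket commutes with pullback along the inverse chart, and on the model space it is the
commutator of directional derivatives. -/
theorem fieldRep_bracket [CompleteSpace E] {v₀ : TM E M} {z : E × E}
    (hz : z ∈ (tchart v₀).target) {ξ η : Field E M} (hξ : ContDiffAt ℝ ∞ (fieldRep v₀ ξ) z)
    (hη : ContDiffAt ℝ ∞ (fieldRep v₀ η) z) :
    fieldRep v₀ (bracket ξ η) z =
      fderiv ℝ (fieldRep v₀ η) z (fieldRep v₀ ξ z) -
        fderiv ℝ (fieldRep v₀ ξ) z (fieldRep v₀ η z) := by
  have hus := (tchart v₀).map_target hz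
  have hzu := (tchart v₀).right_inv hz
  have aux : ∀ {ζ : Field E M}, ContDiffAt ℝ ∞ (fieldRep v₀ ζ) z →
      MDifferentiableAt 𝓘(ℝ, E).tangent 𝓘(ℝ, E).tangent.tangent (Field.toMap ζ)
        ((tchart v₀).symm z) := fun hζ =>
    (contMDiffAt_toMap_of_fieldRep hus _ (by rwa [hzu])).mdifferentiableAt (by simp)
  have hm : minSmoothness ℝ 2 = 2 := minSmoothness_of_isRCLikeNormedField
  have hle : (2 : WithTop ℕ∞) ≤ ∞ := WithTop.coe_le_coe.2 le_top
  have i1 : IsManifold 𝓘(ℝ, E).tangent (minSmoothness ℝ 2) (TM E M) := by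
    rw [hm]; exact IsManifold.of_le (n := ∞) hle
  rw [fieldRep_eq_mpullback hz]
  have h1 := VectorField.mpullback_mlieBracket (I := 𝓘(ℝ, E × E)) (I' := 𝓘(ℝ, E).tangent) (n := ∞)
    (f := (tchart v₀).symm) (V := ξ) (W := η) (x₀ := z) (aux hξ) (aux hη)
    (contMDiffAt_tchart_symm hz) (hm.trans_le hle)
  refine h1.trans ?_
  have ev : ∀ ζ : Field E M,
      VectorField.mpullback 𝓘(ℝ, E × E) 𝓘(ℝ, E).tangent (tchart v₀).symm ζ =ᶠ[𝓝 z]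
        fieldRep v₀ ζ := fun ζ => by
    filter_upwards [eventually_mem_target hz] with z' hz' using (fieldRep_eq_mpullback hz' ζ).symm
  refine ((ev ξ).mlieBracket_vectorField_eq (ev η)).trans ?_
  have hb : ∀ V W : (z : E × E) → TangentSpace 𝓘(ℝ, E × E) z,
      VectorField.mlieBracket 𝓘(ℝ, E × E) V W z = VectorField.lieBracket ℝ V W z := fun V W => by
    rw [← VectorField.mlieBracketWithin_univ, VectorField.mlieBracketWithin_eq_lieBracketWithin]
    exact congrFun (VectorField.lieBracketWithin_univ (𝕜 := ℝ) (V := (V : E × E → E × E))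
      (W := (W : E × E → E × E))) z
  exact hb _ _

theorem tchart_incl {v₀ : TM E M} {q : M} (hq : q ∈ (extChartAt 𝓘(ℝ, E) v₀.proj).source) :
    (tchart v₀ ∘ fun w : E => (⟨q, w⟩ : TM E M)) =
      fun w : E => (extChartAt 𝓘(ℝ, E) v₀.proj q, (fibreMap v₀ q : E →L[ℝ] E) w) :=
  funext fun w => tchart_apply hq w

theorem tfibreMap_vert {v₀ u : TM E M} (hu : u ∈ (tchart v₀).source)
    (w : TangentSpace 𝓘(ℝ, E) u.proj) :
    tfibreMap v₀ u (vert u w) = (0, fibreMap v₀ u.proj w) := by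
  have hi := (contMDiff_incl (E := E) u.proj |>.mdifferentiableAt (x := show E from u.2)
    (by simp)).hasMFDerivAt
  have hc := ((contMDiffAt_tchart hu).mdifferentiableAt (by simp)).hasMFDerivAt
  have e1 := (hc.comp (x := show E from u.2) (f := fun w : E => (⟨u.proj, w⟩ : TM E M)) hi).mfderiv
  rw [tchart_incl (mem_tchart_source.1 hu)] at e1
  have e3 : HasMFDerivAt 𝓘(ℝ, E) 𝓘(ℝ, E × E)
      (fun w : E => (extChartAt 𝓘(ℝ, E) v₀.proj u.proj, (fibreMap v₀ u.proj : E →L[ℝ] E) w))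
      (show E from u.2)
      ((ContinuousLinearMap.inr ℝ E E).comp (fibreMap v₀ u.proj : E →L[ℝ] E)) := by
    have h := (hasFDerivAt_prodMk_right (𝕜 := ℝ) (E := E) (F := E)
      (extChartAt 𝓘(ℝ, E) v₀.proj u.proj) ((fibreMap v₀ u.proj : E →L[ℝ] E) (show E from u.2)))
    exact (h.comp (show E from u.2)
      (fibreMap v₀ u.proj : E →L[ℝ] E).hasFDerivAt).hasMFDerivAt
  rw [e3.mfderiv] at e1
  exact (DFunLike.congr_fun e1 w).symm

theorem fieldRep_vertField {v₀ : TM E M} {z : E × E} (hz : z ∈ (tchart v₀).target) (X : Sec E M) :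
    fieldRep v₀ (vertField X) z = (0, secRep v₀ X z) :=
  tfibreMap_vert ((tchart v₀).map_target hz) _

theorem secRep_projSec {v₀ : TM E M} {z : E × E} (hz : z ∈ (tchart v₀).target) (ξ : Field E M) :
    secRep v₀ (projSec ξ) z = (fieldRep v₀ ξ z).1 :=
  (fst_mfderiv_chart v₀ _ ((tchart v₀).map_target hz) _).symm

theorem tchart_symm_eq {v₀ : TM E M} {q : M} (hq : q ∈ (extChartAt 𝓘(ℝ, E) v₀.proj).source)
    (w : TangentSpace 𝓘(ℝ, E) q) :
    (tchart v₀).symm (extChartAt 𝓘(ℝ, E) v₀.proj q, fibreMap v₀ q w) = (⟨q, w⟩ : TM E M) := by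
  rw [← tchart_apply hq w]
  exact (tchart v₀).left_inv (mem_tchart_source.2 hq)

/-- Along a fibre the chart is a fixed linear map `T`, both on the points of the fibre and on the
values of sections. Conjugating the fibre derivative by `T` therefore produces no correction term.
-/
theorem secRep_vDiffSec {v₀ : TM E M} {z : E × E} (hz : z ∈ (tchart v₀).target) (X Y : Sec E M)
    (hY : DifferentiableAt ℝ (secRep v₀ Y) z) :
    secRep v₀ (vDiffSec X Y) z = fderiv ℝ (secRep v₀ Y) z (0, secRep v₀ X z) := by
  obtain ⟨hz1, hz2⟩ := tchart_symm_coords hz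
  have hq := tchart_symm_mem hz
  set u := (tchart v₀).symm z with hu
  set T : E →L[ℝ] E := fibreMap v₀ u.proj with hT
  obtain ⟨e, he⟩ : T.IsInvertible := fibreMap_isInvertible hq
  have hzz : z = (extChartAt 𝓘(ℝ, E) v₀.proj u.proj, T u.2) := Prod.ext hz1.symm hz2.symm
  have hfun : (fun w : E => (Y ⟨u.proj, w⟩ : E)) = fun w : E =>
      e.symm (secRep v₀ Y (extChartAt 𝓘(ℝ, E) v₀.proj u.proj, T w)) := by
    funext w
    have : secRep v₀ Y (extChartAt 𝓘(ℝ, E) v₀.proj u.proj, T w) = T (Y ⟨u.proj, w⟩) := by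
      have aux : ∀ u' : TM E M, u' = ⟨u.proj, w⟩ → (fibreMap v₀ u'.proj (Y u') : E) =
          T (Y ⟨u.proj, w⟩) := by
        rintro _ rfl; rfl
      exact aux _ (tchart_symm_eq hq w)
    rw [this, ← he]
    exact (e.symm_apply_apply _).symm
  have hd : HasFDerivAt (fun w : E => (Y ⟨u.proj, w⟩ : E))
      ((e.symm : E →L[ℝ] E).comp ((fderiv ℝ (secRep v₀ Y) z).comp
        ((ContinuousLinearMap.inr ℝ E E).comp T))) (show E from u.2) := by
    rw [hfun]
    have h1 := (hasFDerivAt_prodMk_right (𝕜 := ℝ) (E := E) (F := E)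
      (extChartAt 𝓘(ℝ, E) v₀.proj u.proj) (T (show E from u.2))).comp (show E from u.2)
      T.hasFDerivAt
    have h2 : HasFDerivAt (secRep v₀ Y) (fderiv ℝ (secRep v₀ Y) z)
        (extChartAt 𝓘(ℝ, E) v₀.proj u.proj, T (show E from u.2)) := hzz ▸ hY.hasFDerivAt
    have h3 := h2.comp (show E from u.2) h1
    exact (e.symm : E →L[ℝ] E).hasFDerivAt.comp (show E from u.2) h3
  have h5 : vDiffSec X Y u = e.symm (fderiv ℝ (secRep v₀ Y) z (0, T (X u))) :=
    DFunLike.congr_fun hd.fderiv (X u)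
  have h6 : ∀ a : E, T (e.symm a) = a := fun a => by
    rw [← he]; exact e.apply_symm_apply a
  show T (vDiffSec X Y u) = _
  rw [h5]
  exact h6 _

end Coordinates

/-! ### Calculus on `E × E`: vertical derivatives, the curvature identity, the spray equation. -/

section Calculus

variable {E V W : Type*} [NormedAddCommGroup E] [NormedSpace ℝ E]
  [NormedAddCommGroup V] [NormedSpace ℝ V] [NormedAddCommGroup W] [NormedSpace ℝ W]

/-- The partial derivative of a map on `E × E` with respect to the second variable. -/
def vd (A : E × E → V) (z : E × E) : E →L[ℝ] V :=
  (fderiv ℝ A z).comp (ContinuousLinearMap.inr ℝ E E)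

theorem vd_apply (A : E × E → V) (z : E × E) (a : E) : vd A z a = fderiv ℝ A z (0, a) := rfl

theorem contDiffAt_fderiv {A : W → V} {z : W} (h : ContDiffAt ℝ ∞ A z) :
    ContDiffAt ℝ ∞ (fderiv ℝ A) z := h.fderiv_right (by simp)

theorem contDiffAt_vd {A : E × E → V} {z : E × E} (h : ContDiffAt ℝ ∞ A z) :
    ContDiffAt ℝ ∞ (vd A) z := (contDiffAt_fderiv h).clm_comp contDiffAt_const

theorem _root_.ContDiffAt.diff {A : W → V} {z : W} (h : ContDiffAt ℝ ∞ A z) :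
    DifferentiableAt ℝ A z := h.differentiableAt (by simp)

theorem fderiv_apply_apply {A : E × E → W →L[ℝ] V} {Y : E × E → W} {z : E × E}
    (hA : DifferentiableAt ℝ A z) (hY : DifferentiableAt ℝ Y z) (a : E × E) :
    fderiv ℝ (fun z => A z (Y z)) z a = A z (fderiv ℝ Y z a) + fderiv ℝ A z a (Y z) := by
  rw [fderiv_clm_apply hA hY]; rfl

/-- Being C² at a point is an open condition, whereas for C^∞ at a point the neighbourhood may
shrink with the order. Symmetries that are to be differentiated again are therefore proved from C²
alone. -/
theorem _root_.ContDiffAt.two {A : W → V} {z : W} (h : ContDiffAt ℝ ∞ A z) : ContDiffAt ℝ 2 A z :=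
  h.of_le (WithTop.coe_le_coe.2 le_top)

theorem fderiv_vd_of_two {A : E × E → V} {z : E × E} (h : ContDiffAt ℝ 2 A z) (a : E × E) (b : E) :
    fderiv ℝ (vd A) z a b = fderiv ℝ (fderiv ℝ A) z a (0, b) := by
  have hd : DifferentiableAt ℝ (fderiv ℝ A) z :=
    (h.fderiv_right (m := 1) (by norm_num)).differentiableAt (by simp)
  have h1 := fderiv_apply_apply (A := vd A) (hd.clm_comp (differentiableAt_const _))
    (differentiableAt_const b) a
  have h2 := fderiv_apply_apply hd (differentiableAt_const ((0 : E), b)) a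
  simp only [fderiv_fun_const, Pi.zero_apply, zero_apply, map_zero, zero_add] at h1 h2
  rw [← h1, ← h2]; rfl

theorem fderiv_vd {A : E × E → V} {z : E × E} (h : ContDiffAt ℝ ∞ A z) (a : E × E) (b : E) :
    fderiv ℝ (vd A) z a b = fderiv ℝ (fderiv ℝ A) z a (0, b) := fderiv_vd_of_two h.two a b

theorem fderiv_fderiv_symm_of_two {A : W → V} {z : W} (h : ContDiffAt ℝ 2 A z) (a b : W) :
    fderiv ℝ (fderiv ℝ A) z a b = fderiv ℝ (fderiv ℝ A) z b a :=
  (h.isSymmSndFDerivAt (by rw [minSmoothness_of_isRCLikeNormedField])) a b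

theorem fderiv_fderiv_symm {A : W → V} {z : W} (h : ContDiffAt ℝ ∞ A z) (a b : W) :
    fderiv ℝ (fderiv ℝ A) z a b = fderiv ℝ (fderiv ℝ A) z b a := fderiv_fderiv_symm_of_two h.two a b

theorem vd_vd_symm_of_two {A : E × E → V} {z : E × E} (h : ContDiffAt ℝ 2 A z) (a b : E) :
    vd (vd A) z a b = vd (vd A) z b a := by
  rw [vd_apply, vd_apply, fderiv_vd_of_two h, fderiv_vd_of_two h, fderiv_fderiv_symm_of_two h]

theorem vd_vd_symm {A : E × E → V} {z : E × E} (h : ContDiffAt ℝ ∞ A z) (a b : E) :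
    vd (vd A) z a b = vd (vd A) z b a := vd_vd_symm_of_two h.two a b

theorem pair_neg {A : Type*} [AddGroup A] (a : A) : ((0 : A), -a) = -((0 : A), a) := by simp

theorem fderiv_congr {A B : W → V} {z : W} (h : A =ᶠ[𝓝 z] B) (a : W) :
    fderiv ℝ A z a = fderiv ℝ B z a := by rw [h.fderiv_eq]

/-- The horizontal lift at `z` for the coefficients `G` of a semispray. -/
def hor (G : E × E → E) (z : E × E) : E →L[ℝ] E × E :=
  (ContinuousLinearMap.id ℝ E).prod (-(vd G z))

theorem hor_apply (G : E × E → E) (z : E × E) (a : E) : hor G z a = (a, -(vd G z a)) := rfl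

theorem contDiffAt_hor {G : E × E → E} {z : E × E} (h : ContDiffAt ℝ ∞ G z) :
    ContDiffAt ℝ ∞ (hor G) z :=
  (contDiffAt_const (c := ContinuousLinearMap.inl ℝ E E)).sub
    ((contDiffAt_const (c := ContinuousLinearMap.inr ℝ E E)).clm_comp (contDiffAt_vd h))
    |>.congr_of_eventuallyEq (Eventually.of_forall fun z => by ext a <;> simp [hor])

theorem fderiv_hor {G : E × E → E} {z : E × E} (h : ContDiffAt ℝ ∞ G z) (a : E × E) (u : E) :
    fderiv ℝ (hor G) z a u = (0, -(fderiv ℝ (vd G) z a u)) := by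
  have h1 := fderiv_apply_apply (contDiffAt_hor h).diff (differentiableAt_const u) a
  have h2 := fderiv_apply_apply (contDiffAt_vd h).diff (differentiableAt_const u) a
  simp only [fderiv_fun_const, Pi.zero_apply, zero_apply, map_zero,
    zero_add] at h1 h2
  rw [← h1, ← h2]
  simp only [hor_apply]
  have h3 : DifferentiableAt ℝ (fun z => vd G z u) z :=
    (contDiffAt_vd h).diff.clm_apply (differentiableAt_const u)
  have h4 := ((hasFDerivAt_const u z).prodMk h3.hasFDerivAt.neg).fderiv
  exact (DFunLike.congr_fun h4 a)

theorem vd_vd_vd_symm_left {A : E × E → V} {z : E × E} (h : ContDiffAt ℝ ∞ A z) (a b c : E) :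
    vd (vd (vd A)) z a b c = vd (vd (vd A)) z b a c := by
  rw [vd_vd_symm (contDiffAt_vd h)]

theorem fderiv_apply₂ {U : Type*} [NormedAddCommGroup U] [NormedSpace ℝ U]
    {A : W → E →L[ℝ] U →L[ℝ] V} {z : W} (h : DifferentiableAt ℝ A z) (x : W) (a : E) (b : U) :
    fderiv ℝ (fun z => A z a b) z x = fderiv ℝ A z x a b := by
  have h1 := (h.hasFDerivAt.clm_apply (hasFDerivAt_const a z)).clm_apply (hasFDerivAt_const b z)
  rw [h1.fderiv]; simp

/-- The symmetry of the second vertical derivative holds on a neighbourhood, so it survives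
differentiation in any direction. -/
theorem fderiv_vd_vd_symm {A : E × E → V} {z : E × E} (h : ContDiffAt ℝ ∞ A z)
    (x : E × E) (a b : E) :
    fderiv ℝ (vd (vd A)) z x a b = fderiv ℝ (vd (vd A)) z x b a := by
  have hd := (contDiffAt_vd (contDiffAt_vd h)).diff
  rw [← fderiv_apply₂ hd, ← fderiv_apply₂ hd]
  apply fderiv_congr
  filter_upwards [h.two.eventually (by simp)] with z' hz' using vd_vd_symm_of_two hz' a b

theorem vd_vd_vd_symm_right {A : E × E → V} {z : E × E} (h : ContDiffAt ℝ ∞ A z) (a b c : E) :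
    vd (vd (vd A)) z a b c = vd (vd (vd A)) z a c b :=
  fderiv_vd_vd_symm h _ b c

theorem fderiv_vd_vd_vd_symm {A : E × E → V} {z : E × E} (h : ContDiffAt ℝ ∞ A z)
    (x : E × E) (a b c : E) :
    fderiv ℝ (vd (vd (vd A))) z x a b c = fderiv ℝ (vd (vd (vd A))) z x b a c := by
  rw [fderiv_vd_vd_symm (contDiffAt_vd h)]

/-! ### Horizontal derivatives and curvature in coordinates -/

/-- The horizontal differential of a section in coordinates. -/
def hD (G : E × E → E) (X Y : E × E → E) (z : E × E) : E :=
  fderiv ℝ Y z (hor G z (X z)) + vd (vd G) z (X z) (Y z)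

/-- The affine curvature in coordinates. -/
def curv (G : E × E → E) (z : E × E) (a b c : E) : E :=
  fderiv ℝ (vd (vd G)) z (hor G z a) b c - fderiv ℝ (vd (vd G)) z (hor G z b) a c
    + vd (vd G) z a (vd (vd G) z b c) - vd (vd G) z b (vd (vd G) z a c)

/-- The horizontal derivative of the Berwald tensor in coordinates. -/
def hDBerwald (G : E × E → E) (z : E × E) (x a b c : E) : E :=
  fderiv ℝ (vd (vd (vd G))) z (hor G z x) a b c + vd (vd G) z x (vd (vd (vd G)) z a b c)
    - vd (vd (vd G)) z (vd (vd G) z x a) b c - vd (vd (vd G)) z a (vd (vd G) z x b) c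
    - vd (vd (vd G)) z a b (vd (vd G) z x c)

/-- Inherited from the symmetry of third vertical derivatives. It moves the vertical argument of the
curvature identity to the slot where the stretch tensor has it. -/
theorem hDBerwald_symm {G : E × E → E} {z : E × E} (h : ContDiffAt ℝ ∞ G z) (x a b c : E) :
    hDBerwald G z x a b c = hDBerwald G z x b a c := by
  rw [hDBerwald, hDBerwald, fderiv_vd_vd_vd_symm h, vd_vd_vd_symm_left h a b,
    vd_vd_vd_symm_left h (vd (vd G) z x a), vd_vd_vd_symm_left h a (vd (vd G) z x b),
    vd_vd_vd_symm_left h a b]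
  abel

theorem contDiffAt_hD {G : E × E → E} {z : E × E} (h : ContDiffAt ℝ ∞ G z) {X Y : E × E → E}
    (hX : ContDiffAt ℝ ∞ X z) (hY : ContDiffAt ℝ ∞ Y z) : ContDiffAt ℝ ∞ (hD G X Y) z :=
  ((contDiffAt_fderiv hY).clm_apply ((contDiffAt_hor h).clm_apply hX)).add
    (((contDiffAt_vd (contDiffAt_vd h)).clm_apply hX).clm_apply hY)

theorem contDiffAt_curv {G : E × E → E} {z : E × E} (h : ContDiffAt ℝ ∞ G z) {X Y Z : E × E → E}
    (hX : ContDiffAt ℝ ∞ X z) (hY : ContDiffAt ℝ ∞ Y z) (hZ : ContDiffAt ℝ ∞ Z z) :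
    ContDiffAt ℝ ∞ (fun z => curv G z (X z) (Y z) (Z z)) z := by
  have hB := contDiffAt_vd (contDiffAt_vd h)
  have hH := contDiffAt_hor h
  have hd := contDiffAt_fderiv hB
  exact ((((hd.clm_apply (hH.clm_apply hX)).clm_apply hY).clm_apply hZ).sub
    (((hd.clm_apply (hH.clm_apply hY)).clm_apply hX).clm_apply hZ)).add
    ((hB.clm_apply hX).clm_apply ((hB.clm_apply hY).clm_apply hZ)) |>.sub
    ((hB.clm_apply hY).clm_apply ((hB.clm_apply hX).clm_apply hZ))

/-- The vertical derivative of the affine curvature is the alternation of the horizontal derivative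
of the Berwald tensor. -/
theorem vd_curv {G : E × E → E} {z : E × E} (h : ContDiffAt ℝ ∞ G z) {Y Z U : E × E → E} (x : E)
    (hY : ContDiffAt ℝ ∞ Y z) (hZ : ContDiffAt ℝ ∞ Z z) (hU : ContDiffAt ℝ ∞ U z) :
    fderiv ℝ (fun z => curv G z (Y z) (Z z) (U z)) z (0, x)
      - curv G z (fderiv ℝ Y z (0, x)) (Z z) (U z) - curv G z (Y z) (fderiv ℝ Z z (0, x)) (U z)
      - curv G z (Y z) (Z z) (fderiv ℝ U z (0, x)) =
    hDBerwald G z (Y z) x (Z z) (U z) - hDBerwald G z (Z z) x (Y z) (U z) := by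
  have hB := contDiffAt_vd (contDiffAt_vd h)
  have hH := contDiffAt_hor h
  have hd := contDiffAt_fderiv hB
  -- Terms linear in the Christoffel symbols. Commuting the vertical with the horizontal derivative
  -- creates the horizontal derivative of B; the derivative of the horizontal lift itself gives the
  -- term B(Γ(x, Y), Z, U) with a minus sign.
  have k1 : ∀ {Y Z : E × E → E}, ContDiffAt ℝ ∞ Y z → ContDiffAt ℝ ∞ Z z →
      ContDiffAt ℝ ∞ (fun z => fderiv ℝ (vd (vd G)) z (hor G z (Y z)) (Z z) (U z)) z ∧
      fderiv ℝ (fun z => fderiv ℝ (vd (vd G)) z (hor G z (Y z)) (Z z) (U z)) z (0, x) =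
        fderiv ℝ (vd (vd (vd G))) z (hor G z (Y z)) x (Z z) (U z)
        - vd (vd (vd G)) z (vd (vd G) z x (Y z)) (Z z) (U z)
        + fderiv ℝ (vd (vd G)) z (hor G z (fderiv ℝ Y z (0, x))) (Z z) (U z)
        + fderiv ℝ (vd (vd G)) z (hor G z (Y z)) (fderiv ℝ Z z (0, x)) (U z)
        + fderiv ℝ (vd (vd G)) z (hor G z (Y z)) (Z z) (fderiv ℝ U z (0, x)) := by
    intro Y Z hY hZ
    have a1 := hH.clm_apply hY
    have a2 := hd.clm_apply a1
    have a3 := a2.clm_apply hZ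
    have a4 := a3.clm_apply hU
    refine ⟨a4, ?_⟩
    rw [fderiv_apply_apply a3.diff hU.diff, fderiv_apply_apply a2.diff hZ.diff,
      fderiv_apply_apply hd.diff a1.diff, fderiv_apply_apply hH.diff hY.diff, fderiv_hor h,
      fderiv_fderiv_symm hB, ← fderiv_vd hB]
    have e : ((0 : E), -(fderiv ℝ (vd G) z (0, x)) (Y z)) =
        -((0 : E), vd (vd G) z x (Y z)) := pair_neg _
    rw [e, map_add, map_neg, ← vd_apply (vd (vd G))]
    simp only [add_apply, neg_apply]
    abel
  -- Terms quadratic in the Christoffel symbols: they supply those corrections in ∇ʰB that contain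
  -- Γ(Y, ·) or Γ(Z, ·) on `U` or on the value of B.
  have k2 : ∀ {Y Z : E × E → E}, ContDiffAt ℝ ∞ Y z → ContDiffAt ℝ ∞ Z z →
      ContDiffAt ℝ ∞ (fun z => vd (vd G) z (Y z) (vd (vd G) z (Z z) (U z))) z ∧
      fderiv ℝ (fun z => vd (vd G) z (Y z) (vd (vd G) z (Z z) (U z))) z (0, x) =
        vd (vd (vd G)) z x (Y z) (vd (vd G) z (Z z) (U z))
        + vd (vd G) z (fderiv ℝ Y z (0, x)) (vd (vd G) z (Z z) (U z))
        + vd (vd G) z (Y z) (vd (vd (vd G)) z x (Z z) (U z))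
        + vd (vd G) z (Y z) (vd (vd G) z (fderiv ℝ Z z (0, x)) (U z))
        + vd (vd G) z (Y z) (vd (vd G) z (Z z) (fderiv ℝ U z (0, x))) := by
    intro Y Z hY hZ
    have a1 := hB.clm_apply hY
    have a2 := hB.clm_apply hZ
    have a3 := a2.clm_apply hU
    refine ⟨a1.clm_apply a3, ?_⟩
    rw [fderiv_apply_apply a1.diff a3.diff, fderiv_apply_apply a2.diff hU.diff,
      fderiv_apply_apply hB.diff hY.diff, fderiv_apply_apply hB.diff hZ.diff]
    simp only [add_apply, map_add, vd_apply (vd (vd G))]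
    abel
  have hsum : fderiv ℝ (fun z => curv G z (Y z) (Z z) (U z)) z (0, x) =
      fderiv ℝ (fun z => fderiv ℝ (vd (vd G)) z (hor G z (Y z)) (Z z) (U z)) z (0, x)
      - fderiv ℝ (fun z => fderiv ℝ (vd (vd G)) z (hor G z (Z z)) (Y z) (U z)) z (0, x)
      + fderiv ℝ (fun z => vd (vd G) z (Y z) (vd (vd G) z (Z z) (U z))) z (0, x)
      - fderiv ℝ (fun z => vd (vd G) z (Z z) (vd (vd G) z (Y z) (U z))) z (0, x) := by
    have := ((((k1 hY hZ).1.diff.hasFDerivAt).sub ((k1 hZ hY).1.diff.hasFDerivAt)).add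
      ((k2 hY hZ).1.diff.hasFDerivAt)).sub ((k2 hZ hY).1.diff.hasFDerivAt)
    exact DFunLike.congr_fun this.fderiv (0, x)
  rw [hsum, (k1 hY hZ).2, (k1 hZ hY).2, (k2 hY hZ).2, (k2 hZ hY).2]
  simp only [curv, hDBerwald]
  -- The corrections B(x, Γ(Y, Z), U) occur in both ∇ʰB terms and cancel because Γ is symmetric.
  rw [vd_vd_symm h x (Y z), vd_vd_symm h x (Z z), vd_vd_symm h (Z z) (Y z),
    vd_vd_vd_symm_left h (vd (vd G) z (Y z) x) (Z z),
    vd_vd_vd_symm_left h (vd (vd G) z (Z z) x) (Y z),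
    vd_vd_vd_symm_left h x (vd (vd G) z (Y z) (Z z))]
  abel

/-! ### Consequences of the spray equation -/

section Spray

variable {Ω : Set (E × E)} {f : E × E → ℝ} {G : E × E → E}

/-- Coordinate data of a spray: a function `f` (the energy), homogeneous of degree two in the
second variable, and the coefficients `G` of the spray that it determines. -/
structure IsSprayData (Ω : Set (E × E)) (f : E × E → ℝ) (G : E × E → E) : Prop where
  isOpen : IsOpen Ω
  smooth_energy : ∀ z ∈ Ω, ContDiffAt ℝ ∞ f z
  smooth_coeff : ∀ z ∈ Ω, ContDiffAt ℝ ∞ G z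
  euler : ∀ z ∈ Ω, fderiv ℝ f z (0, z.2) = 2 * f z
  eq : ∀ z ∈ Ω, ∀ w : E, fderiv ℝ (fderiv ℝ f) z (z.2, (-2 : ℝ) • G z) (0, w) = fderiv ℝ f z (w, 0)

/-- Euler's relation differentiated once; the last term comes from the dependence of the direction
`(0, z.2)` on the point. -/
theorem euler_deriv (hΩ : IsOpen Ω) (hf : ∀ z ∈ Ω, ContDiffAt ℝ ∞ f z)
    (he : ∀ z ∈ Ω, fderiv ℝ f z (0, z.2) = 2 * f z) {z : E × E} (hz : z ∈ Ω) (a : E × E) :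
    fderiv ℝ (fderiv ℝ f) z a (0, z.2) = 2 * fderiv ℝ f z a - fderiv ℝ f z (0, a.2) := by
  have hj : HasFDerivAt (fun z : E × E => ((0 : E), z.2))
      ((0 : E × E →L[ℝ] E).prod (ContinuousLinearMap.snd ℝ E E)) z :=
    (hasFDerivAt_const (0 : E) z).prodMk hasFDerivAt_snd
  have h1 : fderiv ℝ (fun z => fderiv ℝ f z (0, z.2)) z a = fderiv ℝ (fun z => 2 * f z) z a :=
    fderiv_congr (by filter_upwards [hΩ.mem_nhds hz] with z' hz' using he z' hz') a
  rw [fderiv_apply_apply (contDiffAt_fderiv (hf z hz)).diff hj.differentiableAt, hj.fderiv,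
    fderiv_const_mul (hf z hz).diff] at h1
  simp at h1
  linarith

/-- Differentiate the spray equation vertically along `u` and pair it with w = y. By Euler's
relation the third-order term cancels the right side, leaving D²f(u, -2G'u)(0, y) = 0. By
`euler_deriv` this is twice the assertion. -/
theorem IsSprayData.conservative (h : IsSprayData Ω f G) {z : E × E} (hz : z ∈ Ω) (u : E) :
    fderiv ℝ f z (hor G z u) = 0 := by
  have hf := h.smooth_energy z hz
  have hG := h.smooth_coeff z hz
  have hS : HasFDerivAt (fun z : E × E => (z.2, (-2 : ℝ) • G z))
      ((ContinuousLinearMap.snd ℝ E E).prod ((-2 : ℝ) • fderiv ℝ G z)) z :=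
    hasFDerivAt_snd.prodMk (hG.diff.hasFDerivAt.const_smul (-2 : ℝ))
  have hff := contDiffAt_fderiv hf
  have hfff := contDiffAt_fderiv hff
  have eu : ∀ a : E × E, fderiv ℝ (fderiv ℝ f) z a (0, z.2) =
      2 * fderiv ℝ f z a - fderiv ℝ f z (0, a.2) :=
    fun a => euler_deriv h.isOpen h.smooth_energy h.euler hz a
  have key : ∀ w : E, fderiv ℝ (fderiv ℝ (fderiv ℝ f)) z (0, u) (z.2, (-2 : ℝ) • G z) (0, w) +
      fderiv ℝ (fderiv ℝ f) z (u, (-2 : ℝ) • vd G z u) (0, w) =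
      fderiv ℝ (fderiv ℝ f) z (0, u) (w, 0) := by
    intro w
    have h1 : fderiv ℝ (fun z => fderiv ℝ (fderiv ℝ f) z (z.2, (-2 : ℝ) • G z) (0, w)) z (0, u) =
        fderiv ℝ (fun z => fderiv ℝ f z (w, 0)) z (0, u) :=
      fderiv_congr (by
        filter_upwards [h.isOpen.mem_nhds hz] with z' hz' using h.eq z' hz' w) _
    rw [fderiv_apply_apply (hff.diff) (differentiableAt_const _),
      fderiv_apply_apply (hfff.diff.clm_apply hS.differentiableAt) (differentiableAt_const _),
      fderiv_apply_apply hfff.diff hS.differentiableAt, hS.fderiv] at h1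
    simp only [fderiv_fun_const, Pi.zero_apply, zero_apply, map_zero,
      zero_add, add_apply] at h1
    rw [← h1, add_comm]
    rfl
  have k3 : fderiv ℝ (fderiv ℝ (fderiv ℝ f)) z (0, u) (z.2, (-2 : ℝ) • G z) (0, z.2) =
      fderiv ℝ (fderiv ℝ f) z (0, u) (z.2, 0) := by
    have hj : HasFDerivAt (fun z : E × E => ((0 : E), z.2))
        ((0 : E × E →L[ℝ] E).prod (ContinuousLinearMap.snd ℝ E E)) z :=
      (hasFDerivAt_const (0 : E) z).prodMk hasFDerivAt_snd
    -- The spray vector is frozen at `z`, so that differentiating `euler_deriv` does not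
    -- differentiate G.
    set a : E × E := (z.2, (-2 : ℝ) • G z) with ha
    have h1 : fderiv ℝ (fun z => fderiv ℝ (fderiv ℝ f) z a (0, z.2)) z (0, u) =
        fderiv ℝ (fun z => 2 * fderiv ℝ f z a - fderiv ℝ f z (0, a.2)) z (0, u) :=
      fderiv_congr (by
        filter_upwards [h.isOpen.mem_nhds hz] with z' hz' using
          euler_deriv h.isOpen h.smooth_energy h.euler hz' a) _
    have d1 : DifferentiableAt ℝ (fun z => fderiv ℝ f z a) z :=
      hff.diff.clm_apply (differentiableAt_const _)
    have d2 : DifferentiableAt ℝ (fun z => fderiv ℝ f z (0, a.2)) z :=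
      hff.diff.clm_apply (differentiableAt_const _)
    rw [fderiv_apply_apply (hfff.diff.clm_apply (differentiableAt_const _)) hj.differentiableAt,
      fderiv_apply_apply hfff.diff (differentiableAt_const _), hj.fderiv,
      fderiv_fun_sub (d1.const_mul 2) d2, fderiv_const_mul d1, sub_apply,
      smul_apply, fderiv_apply_apply hff.diff (differentiableAt_const _),
      fderiv_apply_apply hff.diff (differentiableAt_const _)] at h1
    simp only [fderiv_fun_const, Pi.zero_apply, zero_apply, map_zero,
      zero_add, ContinuousLinearMap.prod_apply, smul_eq_mul,
      ContinuousLinearMap.coe_snd'] at h1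
    have e1 : fderiv ℝ (fderiv ℝ f) z (0, u) a = fderiv ℝ (fderiv ℝ f) z (0, u) (z.2, 0) +
        fderiv ℝ (fderiv ℝ f) z (0, u) (0, a.2) := by
      rw [← map_add]; simp [ha]
    rw [fderiv_fderiv_symm hf a (0, u)] at h1
    linarith
  have k4 := key z.2
  rw [k3, eu] at k4
  have e2 : fderiv ℝ f z (u, (-2 : ℝ) • vd G z u) = fderiv ℝ f z (hor G z u) -
      fderiv ℝ f z (0, vd G z u) := by
    rw [← map_sub]; congr 1; ext <;> simp [hor_apply]; module
  have e3 : fderiv ℝ f z (0, (-2 : ℝ) • vd G z u) = -2 * fderiv ℝ f z (0, vd G z u) := by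
    have e : ((0 : E), (-2 : ℝ) • vd G z u) = (-2 : ℝ) • ((0 : E), vd G z u) :=
      Prod.ext (smul_zero _).symm rfl
    rw [e, map_smul, smul_eq_mul]
  simp only at k4
  rw [e2, e3] at k4
  linarith

/-- The vertical differential of the energy is horizontally parallel. -/
theorem IsSprayData.fderiv_vd_hor (h : IsSprayData Ω f G) {z : E × E} (hz : z ∈ Ω) (a u : E) :
    fderiv ℝ (vd f) z (hor G z u) a = vd f z (vd (vd G) z a u) := by
  have hf := h.smooth_energy z hz
  have hG := h.smooth_coeff z hz
  -- Vertical derivative of the conservation law with `u` held constant; the Christoffel term is the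
  -- derivative of the horizontal lift.
  have h1 : fderiv ℝ (fun z => fderiv ℝ f z (hor G z u)) z (0, a) =
      fderiv ℝ (fun _ => (0 : ℝ)) z (0, a) :=
    fderiv_congr (by
      filter_upwards [h.isOpen.mem_nhds hz] with z' hz' using h.conservative hz' u) _
  rw [fderiv_apply_apply (contDiffAt_fderiv hf).diff
    ((contDiffAt_hor hG).diff.clm_apply (differentiableAt_const u)),
    fderiv_apply_apply (contDiffAt_hor hG).diff (differentiableAt_const u), fderiv_hor hG,
    fderiv_fderiv_symm hf, ← fderiv_vd hf] at h1
  simp only [fderiv_fun_const, Pi.zero_apply, zero_apply, map_zero,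
      zero_add] at h1
  have e : fderiv ℝ f z (0, -(fderiv ℝ (vd G) z (0, a) u)) = - vd f z (vd (vd G) z a u) := by
    rw [pair_neg, map_neg]; rfl
  rw [e] at h1
  linarith

/-- The horizontal derivative of the metric in terms of the Berwald tensor. -/
theorem IsSprayData.fderiv_metric_hor (h : IsSprayData Ω f G) {z : E × E} (hz : z ∈ Ω)
    (a b u : E) :
    fderiv ℝ (vd (vd f)) z (hor G z u) b a = vd (vd f) z (vd (vd G) z u b) a +
      vd (vd f) z b (vd (vd G) z u a) + vd f z (vd (vd (vd G)) z u b a) := by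
  have hf := h.smooth_energy z hz
  have hG := h.smooth_coeff z hz
  have hθ := contDiffAt_vd hf
  have hB := contDiffAt_vd (contDiffAt_vd hG)
  -- One more vertical derivative, now of the parallelism of θ: differentiating Γ on the right is
  -- what brings in B.
  have h1 : fderiv ℝ (fun z => fderiv ℝ (vd f) z (hor G z u) a) z (0, b) =
      fderiv ℝ (fun z => vd f z (vd (vd G) z a u)) z (0, b) :=
    fderiv_congr (by
      filter_upwards [h.isOpen.mem_nhds hz] with z' hz' using h.fderiv_vd_hor hz' a u) _
  rw [fderiv_apply_apply ((contDiffAt_fderiv hθ).diff.clm_apply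
      ((contDiffAt_hor hG).diff.clm_apply (differentiableAt_const u))) (differentiableAt_const a),
    fderiv_apply_apply (contDiffAt_fderiv hθ).diff
      ((contDiffAt_hor hG).diff.clm_apply (differentiableAt_const u)),
    fderiv_apply_apply (contDiffAt_hor hG).diff (differentiableAt_const u), fderiv_hor hG,
    fderiv_fderiv_symm hθ, ← fderiv_vd hθ, fderiv_apply_apply hθ.diff
      ((hB.diff.clm_apply (differentiableAt_const a)).clm_apply (differentiableAt_const u)),
    fderiv_apply₂ hB.diff] at h1
  simp only [fderiv_fun_const, Pi.zero_apply, zero_apply, map_zero,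
      zero_add, add_apply] at h1
  have e : fderiv ℝ (vd f) z (0, -(fderiv ℝ (vd G) z (0, b) u)) a =
      - vd (vd f) z (vd (vd G) z u b) a := by
    rw [vd_vd_symm hG u b, pair_neg, map_neg, neg_apply]; rfl
  rw [e] at h1
  rw [vd_vd_vd_symm_left hG u b a, vd_vd_vd_symm_right hG b u a, vd_vd_symm hG u a]
  simp only [vd_apply (vd (vd G)), vd_apply (vd f) z b]
  linarith

/-- The left side is ∇ʰg. The Christoffel terms of `fderiv_metric_hor` are absorbed by the covariant
derivatives of `Y` and `Z`, and only θ∘B remains. -/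
theorem IsSprayData.landsberg (h : IsSprayData Ω f G) {z : E × E} (hz : z ∈ Ω)
    {X Y Z : E × E → E} (hY : ContDiffAt ℝ ∞ Y z) (hZ : ContDiffAt ℝ ∞ Z z) :
    fderiv ℝ (fun z => vd (vd f) z (Y z) (Z z)) z (hor G z (X z))
      - vd (vd f) z (hD G X Y z) (Z z) - vd (vd f) z (Y z) (hD G X Z z) =
    vd f z (vd (vd (vd G)) z (X z) (Y z) (Z z)) := by
  have hg := contDiffAt_vd (contDiffAt_vd (h.smooth_energy z hz))
  rw [fderiv_apply_apply (hg.clm_apply hY).diff hZ.diff, fderiv_apply_apply hg.diff hY.diff,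
    add_apply, h.fderiv_metric_hor hz]
  simp only [hD, map_add, add_apply]
  ring

/-- Since θ is horizontally parallel, the horizontal derivative of θ∘B falls entirely on B. -/
theorem IsSprayData.hDiff_landsberg (h : IsSprayData Ω f G) {z : E × E} (hz : z ∈ Ω)
    {X Y Z U : E × E → E} (hY : ContDiffAt ℝ ∞ Y z) (hZ : ContDiffAt ℝ ∞ Z z)
    (hU : ContDiffAt ℝ ∞ U z) :
    fderiv ℝ (fun z => vd f z (vd (vd (vd G)) z (Y z) (Z z) (U z))) z (hor G z (X z))
      - vd f z (vd (vd (vd G)) z (hD G X Y z) (Z z) (U z))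
      - vd f z (vd (vd (vd G)) z (Y z) (hD G X Z z) (U z))
      - vd f z (vd (vd (vd G)) z (Y z) (Z z) (hD G X U z)) =
    vd f z (hDBerwald G z (X z) (Y z) (Z z) (U z)) := by
  have hG := h.smooth_coeff z hz
  have hT := contDiffAt_vd (contDiffAt_vd (contDiffAt_vd hG))
  have hθ := contDiffAt_vd (h.smooth_energy z hz)
  have a1 := hT.clm_apply hY
  have a2 := a1.clm_apply hZ
  rw [fderiv_apply_apply hθ.diff (a2.clm_apply hU).diff, fderiv_apply_apply a2.diff hU.diff,
    fderiv_apply_apply a1.diff hZ.diff, fderiv_apply_apply hT.diff hY.diff, h.fderiv_vd_hor hz,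
    vd_vd_symm hG _ (X z)]
  simp only [hD, hDBerwald, map_add, map_sub, add_apply]
  ring

end Spray

end Calculus

/-! ### From the tensors on the manifold to their coordinate expressions. -/

section Local

variable {E : Type*} [NormedAddCommGroup E] [NormedSpace ℝ E]
  {M : Type*} [TopologicalSpace M] [ChartedSpace E M] [IsManifold 𝓘(ℝ, E) ∞ M]

theorem secRep_add (v₀ : TM E M) (X Y : Sec E M) (z : E × E) :
    secRep v₀ (X + Y) z = secRep v₀ X z + secRep v₀ Y z := map_add _ _ _

theorem secRep_sub (v₀ : TM E M) (X Y : Sec E M) (z : E × E) :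
    secRep v₀ (X - Y) z = secRep v₀ X z - secRep v₀ Y z := map_sub _ _ _

theorem eventually_mem_dom {v₀ : TM E M} {z : E × E} (hz : z ∈ dom v₀) :
    ∀ᶠ z' in 𝓝 z, z' ∈ dom v₀ := (isOpen_dom v₀).mem_nhds hz

theorem eventuallyEq_of_dom {V : Type*} {v₀ : TM E M} {z : E × E} (hz : z ∈ dom v₀)
    {A B : E × E → V} (h : ∀ z ∈ dom v₀, A z = B z) : A =ᶠ[𝓝 z] B :=
  (eventually_mem_dom hz).mono h

theorem smoothSec_of_dom {X : Sec E M}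
    (h : ∀ (v₀ : TM E M), ∀ z ∈ dom v₀, ContDiffAt ℝ ∞ (secRep v₀ X) z) : SmoothSec X :=
  smoothSec_of_secRep X fun v hv => h v _ (tchart_self_mem_dom hv)

theorem SmoothSec.contDiffAt {X : Sec E M} (h : SmoothSec X) {v₀ : TM E M} {z : E × E}
    (hz : z ∈ dom v₀) : ContDiffAt ℝ ∞ (secRep v₀ X) z := contDiffAt_secRep_of_smoothSec hz h

theorem smoothField_of_dom [CompleteSpace E] {ξ : Field E M}
    (h : ∀ (v₀ : TM E M), ∀ z ∈ dom v₀, ContDiffAt ℝ ∞ (fieldRep v₀ ξ) z) : SmoothField ξ :=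
  smoothField_of_fieldRep ξ fun v hv => h v _ (tchart_self_mem_dom hv)

theorem SmoothField.contDiffAt [CompleteSpace E] {ξ : Field E M} (h : SmoothField ξ) {v₀ : TM E M}
    {z : E × E} (hz : z ∈ dom v₀) : ContDiffAt ℝ ∞ (fieldRep v₀ ξ) z :=
  contDiffAt_fieldRep_of_smoothField hz h

theorem SmoothSec.vDiff {X Y : Sec E M} (hX : SmoothSec X) (hY : SmoothSec Y) :
    SmoothSec (vDiffSec X Y) := smoothSec_of_dom fun v₀ z hz => by
  refine ContDiffAt.congr_of_eventuallyEq ?_ (eventuallyEq_of_dom hz fun z hz =>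
    secRep_vDiffSec hz.1 X Y (hY.contDiffAt hz).diff)
  exact (contDiffAt_fderiv (hY.contDiffAt hz)).clm_apply
    (contDiffAt_const.prodMk (hX.contDiffAt hz))

theorem SmoothSec.vertField [CompleteSpace E] {X : Sec E M} (hX : SmoothSec X) :
    SmoothField (vertField X) := smoothField_of_dom fun _ _ hz =>
  (contDiffAt_const.prodMk (hX.contDiffAt hz)).congr_of_eventuallyEq
    (eventuallyEq_of_dom hz fun _ hz => fieldRep_vertField hz.1 X)

theorem SmoothField.projSec [CompleteSpace E] {ξ : Field E M} (h : SmoothField ξ) :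
    SmoothSec (projSec ξ) := smoothSec_of_dom fun _ z hz =>
  (contDiffAt_fst.comp z (h.contDiffAt hz)).congr_of_eventuallyEq
    (eventuallyEq_of_dom hz fun _ hz => secRep_projSec hz.1 ξ)

theorem SmoothField.bracket [CompleteSpace E] {ξ η : Field E M} (hξ : SmoothField ξ)
    (hη : SmoothField η) : SmoothField (bracket ξ η) := smoothField_of_dom fun v₀ z hz => by
  refine ContDiffAt.congr_of_eventuallyEq ?_ (eventuallyEq_of_dom hz fun z hz =>
    fieldRep_bracket hz.1 (hξ.contDiffAt hz) (hη.contDiffAt hz))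
  exact ((contDiffAt_fderiv (hη.contDiffAt hz)).clm_apply (hξ.contDiffAt hz)).sub
    ((contDiffAt_fderiv (hξ.contDiffAt hz)).clm_apply (hη.contDiffAt hz))

/-! ### Vertical derivatives of functions -/

theorem funRep_vDiffFun {v₀ : TM E M} {z : E × E} (hz : z ∈ (tchart v₀).target) {f : TM E M → ℝ}
    (hf : DifferentiableAt ℝ (funRep v₀ f) z) (X : Sec E M) :
    funRep v₀ (vDiffFun f X) z = vd (funRep v₀ f) z (secRep v₀ X z) := by
  rw [vDiffFun, funRep_applyField hz _ hf, fieldRep_vertField hz]; rfl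

/-- `F` is smooth on the slit tangent manifold. -/
def SmoothOnSlit (F : TM E M → ℝ) : Prop :=
  ContMDiffOn 𝓘(ℝ, E).tangent 𝓘(ℝ, ℝ) ∞ F (slit E M)

theorem SmoothOnSlit.contDiffAt {F : TM E M → ℝ} (h : SmoothOnSlit F) {v₀ : TM E M} {z : E × E}
    (hz : z ∈ dom v₀) : ContDiffAt ℝ ∞ (funRep v₀ F) z :=
  contDiffAt_funRep hz.1
    (ContMDiffOn.contMDiffAt h (isOpen_slit.mem_nhds (tchart_symm_mem_slit hz)))

theorem SmoothOnSlit.contDiffAt_energy {F : TM E M → ℝ} (h : SmoothOnSlit F) {v₀ : TM E M}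
    {z : E × E} (hz : z ∈ dom v₀) : ContDiffAt ℝ ∞ (funRep v₀ (energy F)) z :=
  contDiffAt_const.mul ((h.contDiffAt hz).pow 2)

/-- The term with `vDiffSec X Y` removes the derivative of `Y`, so only the second vertical
derivative is left; the factor ½ matches F² = 2E. -/
theorem SmoothOnSlit.funRep_metric {F : TM E M → ℝ} (h : SmoothOnSlit F) {v₀ : TM E M} {z : E × E}
    (hz : z ∈ dom v₀) {X Y : Sec E M} (hY : SmoothSec Y) :
    funRep v₀ (metric F X Y) z =
      vd (vd (funRep v₀ (energy F))) z (secRep v₀ X z) (secRep v₀ Y z) := by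
  have hf : ∀ z ∈ dom v₀, DifferentiableAt ℝ (funRep v₀ (energy F)) z := fun z hz =>
    (h.contDiffAt_energy hz).diff
  have hF : funRep v₀ (fun u => F u ^ 2) = fun z => 2 * funRep v₀ (energy F) z := by
    funext z; simp only [funRep, energy]; ring
  have hF2 : ∀ z ∈ dom v₀, DifferentiableAt ℝ (funRep v₀ fun u => F u ^ 2) z := fun z hz => by
    rw [hF]; exact (hf z hz).const_mul 2
  have hvd : ∀ z ∈ dom v₀, ∀ a, vd (funRep v₀ fun u => F u ^ 2) z a =
      2 * vd (funRep v₀ (energy F)) z a := fun z hz a => by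
    rw [hF, vd_apply, fderiv_const_mul (hf z hz)]; rfl
  have e1 : funRep v₀ (vDiffFun (fun u => F u ^ 2) Y) =ᶠ[𝓝 z]
      fun z => 2 * vd (funRep v₀ (energy F)) z (secRep v₀ Y z) :=
    eventuallyEq_of_dom hz fun z hz => by
      rw [funRep_vDiffFun hz.1 (hF2 z hz), hvd z hz]
  have hd : DifferentiableAt ℝ (fun z => vd (funRep v₀ (energy F)) z (secRep v₀ Y z)) z :=
    (contDiffAt_vd (h.contDiffAt_energy hz)).diff.clm_apply (hY.contDiffAt hz).diff
  have e2 : funRep v₀ (applyField (Finsler.vertField X) (vDiffFun (fun u => F u ^ 2) Y)) z =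
      2 * (vd (funRep v₀ (energy F)) z (fderiv ℝ (secRep v₀ Y) z (0, secRep v₀ X z)) +
        vd (vd (funRep v₀ (energy F))) z (secRep v₀ X z) (secRep v₀ Y z)) := by
    rw [funRep_applyField hz.1 _ (e1.differentiableAt_iff.2 (hd.const_mul 2)), fderiv_congr e1,
      fieldRep_vertField hz.1, fderiv_const_mul hd, smul_apply,
      fderiv_apply_apply (contDiffAt_vd (h.contDiffAt_energy hz)).diff (hY.contDiffAt hz).diff]
    rfl
  have e3 : funRep v₀ (metric F X Y) z = (1 / 2) *
      (funRep v₀ (applyField (Finsler.vertField X) (vDiffFun (fun u => F u ^ 2) Y)) z -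
        funRep v₀ (vDiffFun (fun u => F u ^ 2) (vDiffSec X Y)) z) := rfl
  rw [e3, e2, funRep_vDiffFun hz.1 (hF2 z hz), hvd z hz,
    secRep_vDiffSec hz.1 X Y (hY.contDiffAt hz).diff]
  ring

/-! ### Connections generated by a semispray, in coordinates -/

/-- The connection `H` has the coefficients `vd (G v₀)` in the chart around `v₀`. -/
structure HasCoeffs (H : Conn E M) (G : TM E M → E × E → E) : Prop where
  smooth : ∀ v₀, ∀ z ∈ dom v₀, ContDiffAt ℝ ∞ (G v₀) z
  eq : ∀ v₀, ∀ z ∈ dom v₀, ∀ w : TangentSpace 𝓘(ℝ, E) ((tchart v₀).symm z).proj,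
    tfibreMap v₀ ((tchart v₀).symm z) (H ((tchart v₀).symm z) w) =
      hor (G v₀) z (fibreMap v₀ ((tchart v₀).symm z).proj w)

namespace HasCoeffs

variable {H : Conn E M} {G : TM E M → E × E → E}

theorem fieldRep_horField (h : HasCoeffs H G) {v₀ : TM E M} {z : E × E} (hz : z ∈ dom v₀)
    (X : Sec E M) : fieldRep v₀ (horField H X) z = hor (G v₀) z (secRep v₀ X z) := h.eq v₀ z hz _

theorem smooth_horField [CompleteSpace E] (h : HasCoeffs H G) {X : Sec E M} (hX : SmoothSec X) :
    SmoothField (horField H X) := smoothField_of_dom fun v₀ z hz =>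
  ((contDiffAt_hor (h.smooth v₀ z hz)).clm_apply (hX.contDiffAt hz)).congr_of_eventuallyEq
    (eventuallyEq_of_dom hz fun _ hz => h.fieldRep_horField hz X)

theorem secRep_vertMap (h : HasCoeffs H G) {v₀ : TM E M} {z : E × E} (hz : z ∈ dom v₀)
    (ξ : Field E M) : secRep v₀ (vertMap H ξ) z =
      (fieldRep v₀ ξ z).2 + vd (G v₀) z (fieldRep v₀ ξ z).1 := by
  set u := (tchart v₀).symm z with hu
  have hus : u ∈ (tchart v₀).source := (tchart v₀).map_target hz.1
  have h1 : tfibreMap v₀ u (ξ u - H u (proj u (ξ u))) =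
      (0, (fieldRep v₀ ξ z).2 + vd (G v₀) z (fieldRep v₀ ξ z).1) := by
    have h2 := h.eq v₀ z hz (proj u (ξ u))
    have h3 : (fibreMap v₀ u.proj (proj u (ξ u)) : E) = (fieldRep v₀ ξ z).1 :=
      secRep_projSec hz.1 ξ
    have h4 := (map_sub (tfibreMap v₀ u) (ξ u) (H u (proj u (ξ u))))
    refine h4.trans ?_
    rw [h2, h3, hor_apply]
    show fieldRep v₀ ξ z - _ = _
    ext <;> simp
  -- `Function.invFun` yields a preimage only for vectors in the range, so the complement of the
  -- horizontal part must first be shown to be vertical.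
  obtain ⟨w, hw⟩ : ∃ w, vert u w = ξ u - H u (proj u (ξ u)) := by
    obtain ⟨e, he⟩ := fibreMap_isInvertible (mem_tchart_source.1 hus)
    refine ⟨e.symm ((fieldRep v₀ ξ z).2 + vd (G v₀) z (fieldRep v₀ ξ z).1), ?_⟩
    apply tfibreMap_injective hus
    rw [h1, tfibreMap_vert hus, ← he]
    exact congrArg (Prod.mk (0 : E)) (e.apply_symm_apply _)
  have hi : vert u (vertMap H ξ u) = ξ u - H u (proj u (ξ u)) := Function.invFun_eq ⟨w, hw⟩
  have h5 := tfibreMap_vert hus (vertMap H ξ u)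
  rw [hi, h1] at h5
  exact (congrArg Prod.snd h5).symm

variable [CompleteSpace E]

/-- In the bracket of `horField H X` with `vertField Y`, the vertical derivative of `X` appears as
part of a horizontal lift and is killed by the vertical map. The Christoffel term comes from the
vertical derivative of the lift `hor`. -/
theorem secRep_hDiffSec (h : HasCoeffs H G) {v₀ : TM E M} {z : E × E} (hz : z ∈ dom v₀)
    {X Y : Sec E M} (hX : SmoothSec X) (hY : SmoothSec Y) :
    secRep v₀ (hDiffSec H X Y) z = hD (G v₀) (secRep v₀ X) (secRep v₀ Y) z := by
  have hG := h.smooth v₀ z hz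
  have hXz := hX.contDiffAt hz
  have hYz := hY.contDiffAt hz
  rw [hDiffSec, h.secRep_vertMap hz, fieldRep_bracket hz.1 ((h.smooth_horField hX).contDiffAt hz)
    (hY.vertField.contDiffAt hz),
    fderiv_congr (eventuallyEq_of_dom hz fun z hz => fieldRep_vertField hz.1 Y),
    fderiv_congr (eventuallyEq_of_dom hz fun z hz => h.fieldRep_horField hz X),
    fieldRep_vertField hz.1, h.fieldRep_horField hz,
    ((hasFDerivAt_const (0 : E) z).prodMk hYz.diff.hasFDerivAt).fderiv,
    fderiv_apply_apply (contDiffAt_hor hG).diff hXz.diff, fderiv_hor hG]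
  simp only [hD, hor_apply, Prod.fst_sub, Prod.snd_sub, Prod.fst_add, Prod.snd_add,
    ContinuousLinearMap.prod_apply, zero_apply, map_sub, map_add, map_zero]
  rw [vd_vd_symm hG (secRep v₀ X z)]
  simp only [vd_apply (vd (G v₀))]
  abel

theorem smooth_hDiffSec (h : HasCoeffs H G) {X Y : Sec E M} (hX : SmoothSec X)
    (hY : SmoothSec Y) : SmoothSec (hDiffSec H X Y) := smoothSec_of_dom fun v₀ z hz =>
  (contDiffAt_hD (h.smooth v₀ z hz) (hX.contDiffAt hz) (hY.contDiffAt hz)).congr_of_eventuallyEq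
    (eventuallyEq_of_dom hz fun _ hz => h.secRep_hDiffSec hz hX hY)

/-- The vertical and the horizontal part of ξ recombine, so `Y` is differentiated along ξ itself;
only the Christoffel term remembers the splitting. -/
theorem secRep_berwald (h : HasCoeffs H G) {v₀ : TM E M} {z : E × E} (hz : z ∈ dom v₀)
    {ξ : Field E M} {Y : Sec E M} (hξ : SmoothField ξ) (hY : SmoothSec Y) :
    secRep v₀ (berwald H ξ Y) z = fderiv ℝ (secRep v₀ Y) z (fieldRep v₀ ξ z) +
      vd (vd (G v₀)) z (fieldRep v₀ ξ z).1 (secRep v₀ Y z) := by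
  rw [berwald, secRep_add, secRep_vDiffSec hz.1 _ _ (hY.contDiffAt hz).diff,
    h.secRep_vertMap hz, h.secRep_hDiffSec hz hξ.projSec hY, hD, secRep_projSec hz.1, ← add_assoc,
    ← map_add]
  congr 2
  ext <;> simp [hor_apply]

theorem smooth_berwald (h : HasCoeffs H G) {ξ : Field E M} {Y : Sec E M} (hξ : SmoothField ξ)
    (hY : SmoothSec Y) : SmoothSec (berwald H ξ Y) := smoothSec_of_dom fun v₀ z hz => by
  refine ContDiffAt.congr_of_eventuallyEq ?_
    (eventuallyEq_of_dom hz fun z hz => h.secRep_berwald hz hξ hY)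
  exact ((contDiffAt_fderiv (hY.contDiffAt hz)).clm_apply (hξ.contDiffAt hz)).add
    (((contDiffAt_vd (contDiffAt_vd (h.smooth v₀ z hz))).clm_apply
      (contDiffAt_fst.comp z (hξ.contDiffAt hz))).clm_apply (hY.contDiffAt hz))

theorem secRep_berwald_berwald (h : HasCoeffs H G) {v₀ : TM E M} {z : E × E} (hz : z ∈ dom v₀)
    {ξ η : Field E M} {Z : Sec E M} (hξ : SmoothField ξ) (hη : SmoothField η) (hZ : SmoothSec Z) :
    secRep v₀ (berwald H ξ (berwald H η Z)) z =
      fderiv ℝ (secRep v₀ Z) z (fderiv ℝ (fieldRep v₀ η) z (fieldRep v₀ ξ z))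
      + fderiv ℝ (fderiv ℝ (secRep v₀ Z)) z (fieldRep v₀ ξ z) (fieldRep v₀ η z)
      + vd (vd (G v₀)) z (fieldRep v₀ η z).1 (fderiv ℝ (secRep v₀ Z) z (fieldRep v₀ ξ z))
      + vd (vd (G v₀)) z (fderiv ℝ (fieldRep v₀ η) z (fieldRep v₀ ξ z)).1 (secRep v₀ Z z)
      + fderiv ℝ (vd (vd (G v₀))) z (fieldRep v₀ ξ z) (fieldRep v₀ η z).1 (secRep v₀ Z z)
      + vd (vd (G v₀)) z (fieldRep v₀ ξ z).1 (fderiv ℝ (secRep v₀ Z) z (fieldRep v₀ η z))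
      + vd (vd (G v₀)) z (fieldRep v₀ ξ z).1
          (vd (vd (G v₀)) z (fieldRep v₀ η z).1 (secRep v₀ Z z)) := by
  have hB := contDiffAt_vd (contDiffAt_vd (h.smooth v₀ z hz))
  have hZz := hZ.contDiffAt hz
  have hηz := hη.contDiffAt hz
  have hη1 : HasFDerivAt (fun z => (fieldRep v₀ η z).1)
    ((ContinuousLinearMap.fst ℝ E E).comp (fderiv ℝ (fieldRep v₀ η) z)) z :=
    hasFDerivAt_fst.comp z hηz.diff.hasFDerivAt
  have d1 : DifferentiableAt ℝ (fun z => fderiv ℝ (secRep v₀ Z) z (fieldRep v₀ η z)) z :=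
    (contDiffAt_fderiv hZz).diff.clm_apply hηz.diff
  have d2 : DifferentiableAt ℝ (fun z => vd (vd (G v₀)) z (fieldRep v₀ η z).1) z :=
    hB.diff.clm_apply hη1.differentiableAt
  rw [h.secRep_berwald hz hξ (h.smooth_berwald hη hZ), h.secRep_berwald hz hη hZ,
    fderiv_congr (eventuallyEq_of_dom hz fun z hz => h.secRep_berwald hz hη hZ),
    fderiv_fun_add d1 (d2.clm_apply hZz.diff), add_apply,
    fderiv_apply_apply (contDiffAt_fderiv hZz).diff hηz.diff,
    fderiv_apply_apply d2 hZz.diff, fderiv_apply_apply hB.diff hη1.differentiableAt, hη1.fderiv]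
  simp only [map_add, add_apply, ContinuousLinearMap.comp_apply, ContinuousLinearMap.coe_fst']
  abel

/-- Second derivatives of `Z` cancel by symmetry, and derivatives of the two fields cancel against
the bracket term. The result is the usual curvature expression in Γ, with horizontal derivatives of
Γ. -/
theorem secRep_affineCurvature (h : HasCoeffs H G) {v₀ : TM E M} {z : E × E} (hz : z ∈ dom v₀)
    {X Y Z : Sec E M} (hX : SmoothSec X) (hY : SmoothSec Y) (hZ : SmoothSec Z) :
    secRep v₀ (affineCurvature H X Y Z) z =
      curv (G v₀) z (secRep v₀ X z) (secRep v₀ Y z) (secRep v₀ Z z) := by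
  have hξ := h.smooth_horField hX
  have hη := h.smooth_horField hY
  rw [affineCurvature, berwaldCurvature, secRep_sub, secRep_sub,
    h.secRep_berwald_berwald hz hξ hη hZ, h.secRep_berwald_berwald hz hη hξ hZ,
    h.secRep_berwald hz (hξ.bracket hη) hZ, fieldRep_bracket hz.1 (hξ.contDiffAt hz)
      (hη.contDiffAt hz), fderiv_fderiv_symm (hZ.contDiffAt hz) (fieldRep v₀ (horField H X) z)]
  simp only [curv, Prod.fst_sub, map_sub, sub_apply, h.fieldRep_horField hz]
  simp only [hor_apply]
  abel

theorem smooth_affineCurvature (h : HasCoeffs H G) {X Y Z : Sec E M} (hX : SmoothSec X)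
    (hY : SmoothSec Y) (hZ : SmoothSec Z) : SmoothSec (affineCurvature H X Y Z) :=
  smoothSec_of_dom fun v₀ z hz =>
    (contDiffAt_curv (h.smooth v₀ z hz) (hX.contDiffAt hz) (hY.contDiffAt hz)
      (hZ.contDiffAt hz)).congr_of_eventuallyEq
    (eventuallyEq_of_dom hz fun _ hz => h.secRep_affineCurvature hz hX hY hZ)

theorem secRep_vDiffAffineCurvature (h : HasCoeffs H G) {v₀ : TM E M} {z : E × E}
    (hz : z ∈ dom v₀) {X Y Z U : Sec E M} (hX : SmoothSec X) (hY : SmoothSec Y) (hZ : SmoothSec Z)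
    (hU : SmoothSec U) :
    secRep v₀ (vDiffAffineCurvature H X Y Z U) z =
      hDBerwald (G v₀) z (secRep v₀ Y z) (secRep v₀ X z) (secRep v₀ Z z) (secRep v₀ U z) -
      hDBerwald (G v₀) z (secRep v₀ Z z) (secRep v₀ X z) (secRep v₀ Y z) (secRep v₀ U z) := by
  rw [vDiffAffineCurvature, secRep_sub, secRep_sub, secRep_sub,
    secRep_vDiffSec hz.1 _ _ ((h.smooth_affineCurvature hY hZ hU).contDiffAt hz).diff,
    h.secRep_affineCurvature hz (hX.vDiff hY) hZ hU,
    h.secRep_affineCurvature hz hY (hX.vDiff hZ) hU,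
    h.secRep_affineCurvature hz hY hZ (hX.vDiff hU),
    secRep_vDiffSec hz.1 X Y (hY.contDiffAt hz).diff,
    secRep_vDiffSec hz.1 X Z (hZ.contDiffAt hz).diff,
    secRep_vDiffSec hz.1 X U (hU.contDiffAt hz).diff,
    fderiv_congr (eventuallyEq_of_dom hz fun z hz => h.secRep_affineCurvature hz hY hZ hU),
    vd_curv (h.smooth v₀ z hz) _ (hY.contDiffAt hz) (hZ.contDiffAt hz) (hU.contDiffAt hz)]

end HasCoeffs

/-! ### The Landsberg and the stretch tensor in coordinates -/

section Stretch

variable [CompleteSpace E] {F : TM E M → ℝ} {G : TM E M → E × E → E}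

theorem funRep_landsberg (hF : SmoothOnSlit F) (h : HasCoeffs (canonicalConnection F) G)
    {v₀ : TM E M} (hS : IsSprayData (dom v₀) (funRep v₀ (energy F)) (G v₀)) {z : E × E}
    (hz : z ∈ dom v₀) {X Y Z : Sec E M} (hX : SmoothSec X) (hY : SmoothSec Y) (hZ : SmoothSec Z) :
    funRep v₀ (landsberg F X Y Z) z = -(1 / 2) * vd (funRep v₀ (energy F)) z
      (vd (vd (vd (G v₀))) z (secRep v₀ X z) (secRep v₀ Y z) (secRep v₀ Z z)) := by
  have ev := eventuallyEq_of_dom hz fun z hz => hF.funRep_metric hz (X := Y) hZ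
  have hd : DifferentiableAt ℝ (funRep v₀ (metric F Y Z)) z :=
    ev.differentiableAt_iff.2 (((contDiffAt_vd (contDiffAt_vd (hF.contDiffAt_energy hz))).clm_apply
      (hY.contDiffAt hz)).clm_apply (hZ.contDiffAt hz)).diff
  have e : funRep v₀ (landsberg F X Y Z) z = -(1 / 2) *
      (funRep v₀ (applyField (horField (canonicalConnection F) X) (metric F Y Z)) z
      - funRep v₀ (metric F (hDiffSec (canonicalConnection F) X Y) Z) z
      - funRep v₀ (metric F Y (hDiffSec (canonicalConnection F) X Z)) z) := rfl
  rw [e, funRep_applyField hz.1 _ hd, fderiv_congr ev, h.fieldRep_horField hz,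
    hF.funRep_metric hz hZ, hF.funRep_metric hz (h.smooth_hDiffSec hX hZ),
    h.secRep_hDiffSec hz hX hY, h.secRep_hDiffSec hz hX hZ,
    hS.landsberg hz (hY.contDiffAt hz) (hZ.contDiffAt hz)]

theorem funRep_hDiffLandsberg (hF : SmoothOnSlit F) (h : HasCoeffs (canonicalConnection F) G)
    {v₀ : TM E M} (hS : IsSprayData (dom v₀) (funRep v₀ (energy F)) (G v₀)) {z : E × E}
    (hz : z ∈ dom v₀) {X Y Z U : Sec E M} (hX : SmoothSec X) (hY : SmoothSec Y) (hZ : SmoothSec Z)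
    (hU : SmoothSec U) :
    funRep v₀ (hDiffLandsberg F X Y Z U) z = -(1 / 2) * vd (funRep v₀ (energy F)) z
      (hDBerwald (G v₀) z (secRep v₀ X z) (secRep v₀ Y z) (secRep v₀ Z z) (secRep v₀ U z)) := by
  have ev := eventuallyEq_of_dom hz fun z hz => funRep_landsberg hF h hS hz hY hZ hU
  have hT := contDiffAt_vd (contDiffAt_vd (contDiffAt_vd (h.smooth v₀ z hz)))
  have hd := ((contDiffAt_vd (hF.contDiffAt_energy hz)).clm_apply
    (((hT.clm_apply (hY.contDiffAt hz)).clm_apply (hZ.contDiffAt hz)).clm_apply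
      (hU.contDiffAt hz))).diff
  have e : funRep v₀ (hDiffLandsberg F X Y Z U) z =
      funRep v₀ (applyField (horField (canonicalConnection F) X) (landsberg F Y Z U)) z
      - funRep v₀ (landsberg F (hDiffSec (canonicalConnection F) X Y) Z U) z
      - funRep v₀ (landsberg F Y (hDiffSec (canonicalConnection F) X Z) U) z
      - funRep v₀ (landsberg F Y Z (hDiffSec (canonicalConnection F) X U)) z := rfl
  rw [e, funRep_applyField hz.1 _ (ev.differentiableAt_iff.2 (hd.const_mul _)), fderiv_congr ev,
    h.fieldRep_horField hz, funRep_landsberg hF h hS hz (h.smooth_hDiffSec hX hY) hZ hU,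
    funRep_landsberg hF h hS hz hY (h.smooth_hDiffSec hX hZ) hU,
    funRep_landsberg hF h hS hz hY hZ (h.smooth_hDiffSec hX hU),
    h.secRep_hDiffSec hz hX hY, h.secRep_hDiffSec hz hX hZ, h.secRep_hDiffSec hz hX hU,
    fderiv_const_mul hd, smul_apply, smul_eq_mul,
    ← hS.hDiff_landsberg hz (hY.contDiffAt hz) (hZ.contDiffAt hz) (hU.contDiffAt hz)]
  ring

/-- θ is applied to the curvature identity. The factor 2 of the stretch tensor and the -½ of the
Landsberg tensor leave a sign, which the interchange of `Y` and `Z` in the stretch tensor absorbs.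
-/
theorem vDiffFun_vDiffAffineCurvature_eq_stretch (hF : SmoothOnSlit F)
    (h : HasCoeffs (canonicalConnection F) G)
    (hS : ∀ v₀, IsSprayData (dom v₀) (funRep v₀ (energy F)) (G v₀)) {v : TM E M}
    (hv : v ∈ slit E M) {X Y Z U : Sec E M} (hX : SmoothSec X) (hY : SmoothSec Y) (hZ : SmoothSec Z)
    (hU : SmoothSec U) :
    vDiffFun (energy F) (vDiffAffineCurvature (canonicalConnection F) X Y Z U) v =
      stretch F Z Y X U v := by
  have hz := tchart_self_mem_dom hv
  have hs := mem_extChartAt_source (I := 𝓘(ℝ, E).tangent) v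
  have hG := h.smooth v _ hz
  rw [stretch, ← funRep_tchart hs (vDiffFun _ _), ← funRep_tchart hs (hDiffLandsberg F Z Y X U),
    ← funRep_tchart hs (hDiffLandsberg F Y Z X U),
    funRep_vDiffFun hz.1 (hF.contDiffAt_energy hz).diff,
    h.secRep_vDiffAffineCurvature hz hX hY hZ hU,
    funRep_hDiffLandsberg hF h (hS v) hz hZ hY hX hU,
    funRep_hDiffLandsberg hF h (hS v) hz hY hZ hX hU, map_sub, hDBerwald_symm hG _ (secRep v X _),
    hDBerwald_symm hG _ (secRep v X _)]
  ring

end Stretch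

end Local

/-! ### Existence, uniqueness and coordinates of the canonical spray. -/

section SprayExistence

variable {E : Type*} [NormedAddCommGroup E] [NormedSpace ℝ E]
  {M : Type*} [TopologicalSpace M] [ChartedSpace E M] [IsManifold 𝓘(ℝ, E) ∞ M]

/-! ### Vector fields with prescribed values -/

/-- A local extension is cut off by a bump function. Hence conditions stated for global fields, such
as nondegeneracy and the formula for the connection, can be tested on any single tangent vector. -/
theorem exists_smoothVectorField [FiniteDimensional ℝ E] [T2Space M] (p : M)
    (w : TangentSpace 𝓘(ℝ, E) p) :
    ∃ X : (p : M) → TangentSpace 𝓘(ℝ, E) p, SmoothVectorField X ∧ X p = w := by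
  obtain ⟨s, hs, hX⟩ := FiberBundle.exists_contMDiffOn_extend 𝓘(ℝ, E) E
    (V := (TangentSpace 𝓘(ℝ, E) : M → Type _)) (k := ∞) w
  obtain ⟨ρ, -, hρ⟩ := (SmoothBumpFunction.nhds_basis_tsupport (I := 𝓘(ℝ, E)) p).mem_iff.1
    (interior_mem_nhds.2 hs)
  refine ⟨(ρ : M → ℝ) • FiberBundle.extend E w, ?_, ?_⟩
  · exact ContMDiffOn.smul_section_of_tsupport (u := interior s) ρ.contMDiff.contMDiffOn
      isOpen_interior hρ (hX.mono interior_subset)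
  · show ρ p • FiberBundle.extend E w p = w
    rw [ρ.eq_one, one_smul]
    simp

theorem smoothSec_basic {X : (p : M) → TangentSpace 𝓘(ℝ, E) p} (hX : SmoothVectorField X) :
    SmoothSec (basic X) :=
  (ContMDiff.comp hX (Bundle.contMDiff_proj (IB := 𝓘(ℝ, E))
    (TangentSpace 𝓘(ℝ, E) : M → Type _))).contMDiffOn

/-- A vector field with constant components `b` in the chart around `v₀`. -/
def constField (v₀ : TM E M) (b : E × E) : Field E M := fun u => (tfibreMap v₀ u).inverse b

theorem fieldRep_constField {v₀ : TM E M} (b : E × E) {z : E × E} (hz : z ∈ (tchart v₀).target) :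
    fieldRep v₀ (constField v₀ b) z = b := by
  obtain ⟨e, he⟩ := tfibreMap_isInvertible ((tchart v₀).map_target hz)
  rw [fieldRep, constField, ← he, ContinuousLinearMap.inverse_equiv]
  exact e.apply_symm_apply b

theorem contDiffAt_fieldRep_constField {v₀ : TM E M} (b : E × E) {z : E × E}
    (hz : z ∈ (tchart v₀).target) : ContDiffAt ℝ ∞ (fieldRep v₀ (constField v₀ b)) z :=
  contDiffAt_const.congr_of_eventuallyEq
    ((eventually_mem_target hz).mono fun _ hz => fieldRep_constField b hz)

theorem constField_apply {v₀ u : TM E M} (hu : u ∈ (tchart v₀).source)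
    (s : TangentSpace 𝓘(ℝ, E).tangent u) : constField v₀ (tfibreMap v₀ u s) u = s := by
  apply tfibreMap_injective hu
  rw [← fieldRep_tchart hu, fieldRep_constField _ ((tchart v₀).map_source hu)]

/-! ### The energy of a Finsler function in coordinates -/

theorem IsFinslerFunction.metric_nondegenerate [FiniteDimensional ℝ E] [T2Space M]
    {F : TM E M → ℝ} (hF : IsFinslerFunction F) {v₀ : TM E M} {z : E × E} (hz : z ∈ dom v₀) (a : E)
    (h : ∀ b, vd (vd (funRep v₀ (energy F))) z a b = 0) : a = 0 := by
  have hs : SmoothOnSlit F := hF.smooth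
  set u := (tchart v₀).symm z with hu
  obtain ⟨e, he⟩ := fibreMap_isInvertible (tchart_symm_mem hz.1)
  have hea : (fibreMap v₀ u.proj (e.symm a) : E) = a := by
    rw [← he]; exact e.apply_symm_apply a
  obtain ⟨X, hX, hXu⟩ := exists_smoothVectorField u.proj (e.symm a)
  have h0 : basic X u = 0 := hF.nondegenerate u (tchart_symm_mem_slit hz) _ (smoothSec_basic hX)
    fun Y hY => by
      have h1 := hs.funRep_metric hz (X := basic X) hY
      have h2 : secRep v₀ (basic X) z = a := by
        rw [← hea, ← hXu]; rfl
      rw [h2, h] at h1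
      exact h1
  have h3 : e.symm a = 0 := hXu.symm.trans h0
  rw [← hea, h3]
  exact map_zero _

theorem IsFinslerFunction.energy_smul {F : TM E M → ℝ} (hF : IsFinslerFunction F) {v₀ : TM E M}
    {z : E × E} (hz : z ∈ (tchart v₀).target) {c : ℝ} (hc : 0 ≤ c) :
    funRep v₀ (energy F) (z.1, c • z.2) = c ^ 2 * funRep v₀ (energy F) z := by
  obtain ⟨h1, h2⟩ := tchart_symm_coords hz
  have hq := tchart_symm_mem hz
  set u := (tchart v₀).symm z with hu
  have h3 := tchart_symm_eq hq (c • u.2)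
  rw [map_smul, h1] at h3
  have h4 : (tchart v₀).symm (z.1, c • z.2) = (⟨u.proj, c • u.2⟩ : TM E M) := by
    rw [← h3]; congr 3; exact h2.symm
  rw [funRep, h4, energy, hF.homogeneous u.proj u.2 c hc]
  show _ = c ^ 2 * ((1 / 2) * F u ^ 2)
  have : F (⟨u.proj, u.2⟩ : TM E M) = F u := rfl
  rw [this]; ring

theorem IsFinslerFunction.euler {F : TM E M → ℝ} (hF : IsFinslerFunction F) {v₀ : TM E M}
    {z : E × E} (hz : z ∈ dom v₀) :
    fderiv ℝ (funRep v₀ (energy F)) z (0, z.2) = 2 * funRep v₀ (energy F) z := by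
  have hs : SmoothOnSlit F := hF.smooth
  have hc : HasDerivAt (fun c : ℝ => (z.1, c • z.2)) ((0 : E), z.2) 1 := by
    have := (hasDerivAt_const (1 : ℝ) z.1).prodMk ((hasDerivAt_id (1 : ℝ)).smul_const z.2)
    simpa using this
  have hz1 : (z.1, (1 : ℝ) • z.2) = z := by rw [one_smul]
  have hd : HasFDerivAt (funRep v₀ (energy F)) (fderiv ℝ (funRep v₀ (energy F)) z)
      (z.1, (1 : ℝ) • z.2) := by
    rw [hz1]; exact (hs.contDiffAt_energy hz).diff.hasFDerivAt
  have h1 := hd.comp_hasDerivAt (1 : ℝ) hc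
  have h2 : HasDerivAt (fun c : ℝ => c ^ 2 * funRep v₀ (energy F) z)
      (2 * funRep v₀ (energy F) z) 1 := by
    simpa using (hasDerivAt_pow 2 (1 : ℝ)).mul_const (funRep v₀ (energy F) z)
  refine h1.unique (h2.congr_of_eventuallyEq ?_)
  -- Homogeneity is available for nonnegative factors only, and these include a neighbourhood of 1.
  filter_upwards [lt_mem_nhds (zero_lt_one' ℝ)] with c hc using hF.energy_smul hz.1 hc.le

/-- The derivatives of the two fields cancel against the bracket term, so the value depends only on
the vectors at the point. -/
theorem SmoothOnSlit.funRep_ddJ [CompleteSpace E] {F : TM E M → ℝ} (h : SmoothOnSlit F)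
    {v₀ : TM E M} {z : E × E} (hz : z ∈ dom v₀) {ξ η : Field E M}
    (hξ : ContDiffAt ℝ ∞ (fieldRep v₀ ξ) z) (hη : ContDiffAt ℝ ∞ (fieldRep v₀ η) z) :
    funRep v₀ (ddJ (energy F) ξ η) z =
      fderiv ℝ (fderiv ℝ (funRep v₀ (energy F))) z (fieldRep v₀ ξ z) (0, (fieldRep v₀ η z).1) -
      fderiv ℝ (fderiv ℝ (funRep v₀ (energy F))) z (fieldRep v₀ η z) (0, (fieldRep v₀ ξ z).1) := by
  have hf := h.contDiffAt_energy hz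
  have hdJ : ∀ ζ : Field E M, ∀ z ∈ dom v₀, funRep v₀ (dJ (energy F) ζ) z =
      fderiv ℝ (funRep v₀ (energy F)) z (0, (fieldRep v₀ ζ z).1) := fun ζ z hz => by
    rw [dJ, funRep_applyField hz.1 _ (h.contDiffAt_energy hz).diff, vertEnd,
      fieldRep_vertField hz.1, secRep_projSec hz.1]
  have hpair : ∀ {ζ : Field E M}, ContDiffAt ℝ ∞ (fieldRep v₀ ζ) z →
      HasFDerivAt (fun z => ((0 : E), (fieldRep v₀ ζ z).1))
        ((0 : E × E →L[ℝ] E).prod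
          ((ContinuousLinearMap.fst ℝ E E).comp (fderiv ℝ (fieldRep v₀ ζ) z))) z := fun hζ =>
    (hasFDerivAt_const (0 : E) z).prodMk (hasFDerivAt_fst.comp z hζ.diff.hasFDerivAt)
  have happ : ∀ (ζ : Field E M) {θ : Field E M}, ContDiffAt ℝ ∞ (fieldRep v₀ θ) z →
      funRep v₀ (applyField ζ (dJ (energy F) θ)) z =
        fderiv ℝ (funRep v₀ (energy F)) z (0, (fderiv ℝ (fieldRep v₀ θ) z (fieldRep v₀ ζ z)).1) +
        fderiv ℝ (fderiv ℝ (funRep v₀ (energy F))) z (fieldRep v₀ ζ z) (0, (fieldRep v₀ θ z).1) :=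
    fun ζ θ hθ => by
      have ev := eventuallyEq_of_dom hz (hdJ θ)
      have hd := (contDiffAt_fderiv hf).diff.clm_apply (hpair hθ).differentiableAt
      rw [funRep_applyField hz.1 _ (ev.differentiableAt_iff.2 hd), fderiv_congr ev,
        fderiv_apply_apply (contDiffAt_fderiv hf).diff (hpair hθ).differentiableAt,
        (hpair hθ).fderiv]
      rfl
  have e : funRep v₀ (ddJ (energy F) ξ η) z =
      funRep v₀ (applyField ξ (dJ (energy F) η)) z - funRep v₀ (applyField η (dJ (energy F) ξ)) z
        - funRep v₀ (dJ (energy F) (bracket ξ η)) z := rfl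
  rw [e, happ ξ hη, happ η hξ, hdJ _ z hz, fieldRep_bracket hz.1 hξ hη]
  have e2 : ((0 : E), (fderiv ℝ (fieldRep v₀ η) z (fieldRep v₀ ξ z) -
      fderiv ℝ (fieldRep v₀ ξ) z (fieldRep v₀ η z)).1) =
      ((0 : E), (fderiv ℝ (fieldRep v₀ η) z (fieldRep v₀ ξ z)).1) -
      ((0 : E), (fderiv ℝ (fieldRep v₀ ξ) z (fieldRep v₀ η z)).1) := by simp
  rw [e2, map_sub]
  ring

/-! ### The coefficients of the canonical spray -/

/-- The coefficients `G` of the canonical spray, for an energy function `f` in coordinates. -/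
def sprayCoeff (f : E × E → ℝ) (z : E × E) : E :=
  (1 / 2 : ℝ) • (vd (vd f) z).inverse
    (fderiv ℝ (vd f) z (z.2, 0) - (fderiv ℝ f z).comp (ContinuousLinearMap.inl ℝ E E))

theorem isInvertible_of_nondegenerate [FiniteDimensional ℝ E] (g : E →L[ℝ] E →L[ℝ] ℝ)
    (h : ∀ a, (∀ b, g a b = 0) → a = 0) : g.IsInvertible := by
  have hi : Function.Injective g := by
    rw [injective_iff_map_eq_zero]
    exact fun a ha => h a fun b => by rw [ha]; rfl
  have hd : Module.finrank ℝ E = Module.finrank ℝ (E →L[ℝ] ℝ) := by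
    rw [← (LinearMap.toContinuousLinearMap (𝕜 := ℝ) (E := E) (F' := ℝ)).finrank_eq]
    exact (Subspace.dual_finrank_eq).symm
  exact ⟨(LinearMap.linearEquivOfInjective (g : E →ₗ[ℝ] E →L[ℝ] ℝ) hi hd).toContinuousLinearEquiv,
    rfl⟩

theorem contDiffAt_sprayCoeff [CompleteSpace E] {f : E × E → ℝ} {z : E × E}
    (hf : ContDiffAt ℝ ∞ f z) (hg : (vd (vd f) z).IsInvertible) :
    ContDiffAt ℝ ∞ (sprayCoeff f) z := by
  have h1 : ContDiffAt ℝ ∞ (fun z => (vd (vd f) z).inverse) z :=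
    ContDiffAt.comp z hg.contDiffAt_map_inverse (contDiffAt_vd (contDiffAt_vd hf))
  exact contDiffAt_const.smul (h1.clm_apply
    (((contDiffAt_fderiv (contDiffAt_vd hf)).clm_apply (contDiffAt_snd.prodMk contDiffAt_const)).sub
      ((contDiffAt_fderiv hf).clm_comp contDiffAt_const)))

theorem sprayCoeff_eq {f : E × E → ℝ} {z : E × E} (hf : ContDiffAt ℝ ∞ f z)
    (hg : (vd (vd f) z).IsInvertible) (w : E) :
    fderiv ℝ (fderiv ℝ f) z (z.2, (-2 : ℝ) • sprayCoeff f z) (0, w) = fderiv ℝ f z (w, 0) := by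
  obtain ⟨e, he⟩ := hg
  have h1 : vd (vd f) z (sprayCoeff f z) = (1 / 2 : ℝ) • (fderiv ℝ (vd f) z (z.2, 0) -
      (fderiv ℝ f z).comp (ContinuousLinearMap.inl ℝ E E)) := by
    rw [sprayCoeff, map_smul, ← he, ContinuousLinearMap.inverse_equiv]
    exact congrArg _ (e.apply_symm_apply _)
  have h2 : (z.2, (-2 : ℝ) • sprayCoeff f z) =
      (z.2, (0 : E)) + (-2 : ℝ) • ((0 : E), sprayCoeff f z) := by simp
  rw [← fderiv_vd hf, h2, map_add, map_smul, ← vd_apply (vd f), h1, smul_smul]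
  norm_num

/-- The pairing whose kernel condition determines the spray. -/
def sprayForm (f : E × E → ℝ) (z s b : E × E) : ℝ :=
  fderiv ℝ (fderiv ℝ f) z s (0, b.1) - fderiv ℝ (fderiv ℝ f) z b (0, s.1) + fderiv ℝ f z b

/-- The coefficients were chosen to solve the equation for `b` of the form (w, 0). The remaining,
vertical directions hold automatically by Euler's relation. -/
theorem IsSprayData.sprayForm_eq_zero {Ω : Set (E × E)} {f : E × E → ℝ} {G : E × E → E}
    (h : IsSprayData Ω f G) {z : E × E} (hz : z ∈ Ω) (b : E × E) :
    sprayForm f z (z.2, (-2 : ℝ) • G z) b = 0 := by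
  rw [sprayForm, h.eq z hz, euler_deriv h.isOpen h.smooth_energy h.euler hz]
  have : fderiv ℝ f z b = fderiv ℝ f z (b.1, 0) + fderiv ℝ f z (0, b.2) := by
    rw [← map_add]; simp
  rw [this]; ring

/-- Nondegeneracy of the two-form d d_J E: testing the difference on vertical vectors makes its base
component vanish, and testing it on vectors (b, 0) then does the same for the fibre component. -/
theorem sprayForm_unique {f : E × E → ℝ} {z : E × E} (hf : ContDiffAt ℝ ∞ f z)
    (hg : ∀ a, (∀ b, vd (vd f) z a b = 0) → a = 0) {s s' : E × E} (h : ∀ b, sprayForm f z s b = 0)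
    (h' : ∀ b, sprayForm f z s' b = 0) : s = s' := by
  have key : ∀ b : E × E, fderiv ℝ (fderiv ℝ f) z (s - s') (0, b.1) =
      fderiv ℝ (fderiv ℝ f) z b (0, (s - s').1) := fun b => by
    have h1 := h b
    have h2 := h' b
    simp only [sprayForm] at h1 h2
    have e : ((0 : E), (s - s').1) = (0, s.1) - (0, s'.1) := by simp
    rw [e, map_sub, map_sub, sub_apply]
    linarith
  have hd : ∀ a b : E, vd (vd f) z a b = fderiv ℝ (fderiv ℝ f) z (0, a) (0, b) := fun a b =>
    fderiv_vd hf _ _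
  have h1 : (s - s').1 = 0 := hg _ fun b => by
    rw [vd_vd_symm hf, hd, ← key (0, b)]
    exact map_zero _
  have h2 : (s - s').2 = 0 := hg _ fun b => by
    have e : ((0 : E), (s - s').2) = s - s' := Prod.ext h1.symm rfl
    rw [hd, e, key (b, 0), h1]
    exact map_zero _
  exact sub_eq_zero.1 (Prod.ext h1 h2)

theorem SmoothOnSlit.ddJ_add_applyField [CompleteSpace E] {F : TM E M → ℝ}
    (h : SmoothOnSlit F) {v₀ : TM E M} {z : E × E}
    (hz : z ∈ dom v₀) {ξ η : Field E M} (hξ : ContDiffAt ℝ ∞ (fieldRep v₀ ξ) z)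
    (hη : ContDiffAt ℝ ∞ (fieldRep v₀ η) z) :
    ddJ (energy F) ξ η ((tchart v₀).symm z) + applyField η (energy F) ((tchart v₀).symm z) =
      sprayForm (funRep v₀ (energy F)) z (fieldRep v₀ ξ z) (fieldRep v₀ η z) := by
  rw [sprayForm, ← h.funRep_ddJ hz hξ hη,
    ← funRep_applyField hz.1 _ (h.contDiffAt_energy hz).diff]
  rfl

/-- The defining form of the spray does not depend on the chart. -/
theorem SmoothOnSlit.sprayForm_chart [CompleteSpace E] {F : TM E M → ℝ}
    (h : SmoothOnSlit F) {v₀ v₁ u : TM E M} (hu : u ∈ slit E M)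
    (h₀ : u ∈ (tchart v₀).source) (h₁ : u ∈ (tchart v₁).source)
    (s b : TangentSpace 𝓘(ℝ, E).tangent u) :
    sprayForm (funRep v₀ (energy F)) (tchart v₀ u) (tfibreMap v₀ u s) (tfibreMap v₀ u b) =
      sprayForm (funRep v₁ (energy F)) (tchart v₁ u) (tfibreMap v₁ u s) (tfibreMap v₁ u b) := by
  have hz₀ := tchart_mem_dom h₀ hu
  have hz₁ := tchart_mem_dom h₁ hu
  have c₀ := fun a => contDiffAt_fieldRep_constField a hz₀.1
  have c₁ := fun a => contDiffAt_fieldRep h₁ _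
    (contMDiffAt_toMap_of_fieldRep h₀ (constField v₀ a) (c₀ a))
  have e₀ := h.ddJ_add_applyField hz₀ (c₀ (tfibreMap v₀ u s)) (c₀ (tfibreMap v₀ u b))
  have e₁ := h.ddJ_add_applyField hz₁ (c₁ (tfibreMap v₀ u s)) (c₁ (tfibreMap v₀ u b))
  rw [(tchart v₀).left_inv h₀, fieldRep_constField _ hz₀.1, fieldRep_constField _ hz₀.1] at e₀
  rw [(tchart v₁).left_inv h₁, fieldRep_tchart h₁, fieldRep_tchart h₁, constField_apply h₀,
    constField_apply h₀] at e₁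
  exact e₀.symm.trans e₁

/-- The coefficients of the canonical spray of `F` in the chart around `v₀`. -/
def finslerCoeff (F : TM E M → ℝ) (v₀ : TM E M) : E × E → E := sprayCoeff (funRep v₀ (energy F))

variable [FiniteDimensional ℝ E] [T2Space M] {F : TM E M → ℝ}

theorem IsFinslerFunction.isInvertible_metric (hF : IsFinslerFunction F) {v₀ : TM E M} {z : E × E}
    (hz : z ∈ dom v₀) : (vd (vd (funRep v₀ (energy F))) z).IsInvertible :=
  isInvertible_of_nondegenerate _ (hF.metric_nondegenerate hz)

theorem IsFinslerFunction.isSprayData (hF : IsFinslerFunction F) (v₀ : TM E M) :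
    IsSprayData (dom v₀) (funRep v₀ (energy F)) (finslerCoeff F v₀) where
  isOpen := isOpen_dom v₀
  smooth_energy _ hz := SmoothOnSlit.contDiffAt_energy hF.smooth hz
  smooth_coeff _ hz :=
    have := FiniteDimensional.complete ℝ E
    contDiffAt_sprayCoeff (SmoothOnSlit.contDiffAt_energy hF.smooth hz) (hF.isInvertible_metric hz)
  euler _ hz := hF.euler hz
  eq _ hz := sprayCoeff_eq (SmoothOnSlit.contDiffAt_energy hF.smooth hz) (hF.isInvertible_metric hz)

variable [CompleteSpace E]

/-- The canonical spray, built from its coordinate expression. -/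
def sprayField (F : TM E M → ℝ) : Field E M := fun v =>
  open Classical in
  if v ∈ slit E M then ((tchart v v).2, (-2 : ℝ) • finslerCoeff F v (tchart v v)) else 0

/-- The field is defined at each vector by that vector's own chart. The spray equation is chart
independent and has a unique solution, so the same formula holds throughout any fixed chart, whence
smoothness. -/
theorem IsFinslerFunction.fieldRep_sprayField (hF : IsFinslerFunction F) {v₀ : TM E M} {z : E × E}
    (hz : z ∈ dom v₀) :
    fieldRep v₀ (sprayField F) z = (z.2, (-2 : ℝ) • finslerCoeff F v₀ z) := by
  have hs : SmoothOnSlit F := hF.smooth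
  set u := (tchart v₀).symm z with hu
  have hus := tchart_symm_mem_slit hz
  have h₀ : u ∈ (tchart v₀).source := (tchart v₀).map_target hz.1
  have h₁ : u ∈ (tchart u).source := mem_extChartAt_source u
  have hz' : tchart v₀ u = z := (tchart v₀).right_inv hz.1
  refine sprayForm_unique (hs.contDiffAt_energy hz) (hF.metric_nondegenerate hz) (fun b => ?_)
    ((hF.isSprayData v₀).sprayForm_eq_zero hz)
  have hb : tfibreMap v₀ u (constField v₀ b u) = b := by
    rw [← fieldRep_tchart h₀, hz', fieldRep_constField b hz.1]
  have h2 := hs.sprayForm_chart hus h₀ h₁ (sprayField F u) (constField v₀ b u)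
  rw [hb, hz'] at h2
  refine h2.trans ?_
  have h3 : (tfibreMap u u (sprayField F u) : E × E) =
      ((tchart u u).2, (-2 : ℝ) • finslerCoeff F u (tchart u u)) := by
    rw [tfibreMap_self]
    exact if_pos hus
  rw [h3]
  exact (hF.isSprayData u).sprayForm_eq_zero (tchart_self_mem_dom hus) _

theorem IsFinslerFunction.isCanonicalSpray_sprayField (hF : IsFinslerFunction F) :
    IsCanonicalSpray F (sprayField F) := by
  have hs : SmoothOnSlit F := hF.smooth
  have hc : ∀ v₀ : TM E M, ∀ z ∈ dom v₀, ContDiffAt ℝ ∞ (fieldRep v₀ (sprayField F)) z :=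
    fun v₀ z hz => (contDiffAt_snd.prodMk (contDiffAt_const.smul
      ((hF.isSprayData v₀).smooth_coeff z hz))).congr_of_eventuallyEq
        (eventuallyEq_of_dom hz fun _ hz => hF.fieldRep_sprayField hz)
  refine ⟨fun v hv => if_neg hv, smoothField_of_dom hc, fun v hv ξ hξ => ?_⟩
  have hz := tchart_self_mem_dom hv
  have h₁ := mem_extChartAt_source (I := 𝓘(ℝ, E).tangent) v
  have h := hs.ddJ_add_applyField hz (hc v _ hz) (contDiffAt_fieldRep h₁ ξ hξ)
  rw [hF.fieldRep_sprayField hz, (hF.isSprayData v).sprayForm_eq_zero hz,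
    (tchart v).left_inv h₁] at h
  linarith

/-- The explicit field serves only as the witness that makes the choice operator meaningful. -/
theorem IsFinslerFunction.isCanonicalSpray (hF : IsFinslerFunction F) :
    IsCanonicalSpray F (canonicalSpray F) :=
  Classical.epsilon_spec ⟨_, hF.isCanonicalSpray_sprayField⟩

theorem IsFinslerFunction.fieldRep_canonicalSpray (hF : IsFinslerFunction F) {v₀ : TM E M}
    {z : E × E} (hz : z ∈ dom v₀) :
    fieldRep v₀ (canonicalSpray F) z = (z.2, (-2 : ℝ) • finslerCoeff F v₀ z) := by
  have hs : SmoothOnSlit F := hF.smooth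
  have hS := hF.isCanonicalSpray
  refine sprayForm_unique (hs.contDiffAt_energy hz) (hF.metric_nondegenerate hz) (fun b => ?_)
    ((hF.isSprayData v₀).sprayForm_eq_zero hz)
  have hb := contDiffAt_fieldRep_constField b hz.1
  have h := hs.ddJ_add_applyField hz (hS.smooth.contDiffAt hz) hb
  rw [fieldRep_constField b hz.1] at h
  have hz' := (tchart v₀).right_inv hz.1
  rw [← h, hS.eq _ (tchart_symm_mem_slit hz) _
    (contMDiffAt_toMap_of_fieldRep ((tchart v₀).map_target hz.1) _ (by rwa [hz']))]
  ring

end SprayExistence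

/-! ### Complete lifts and the canonical connection. -/

section ConnectionExistence

variable {E : Type*} [NormedAddCommGroup E] [NormedSpace ℝ E]
  {M : Type*} [TopologicalSpace M] [ChartedSpace E M] [IsManifold 𝓘(ℝ, E) ∞ M]

/-! ### Functions and vector fields on the base manifold in coordinates -/

/-- A vector field on `M` in coordinates. -/
def baseRep (v₀ : TM E M) (X : (p : M) → TangentSpace 𝓘(ℝ, E) p) (x : E) : E :=
  fibreMap v₀ ((extChartAt 𝓘(ℝ, E) v₀.proj).symm x) (X ((extChartAt 𝓘(ℝ, E) v₀.proj).symm x))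

/-- A function on `M` in coordinates. -/
def baseFun (v₀ : TM E M) (f : M → ℝ) (x : E) : ℝ := f ((extChartAt 𝓘(ℝ, E) v₀.proj).symm x)

theorem tchart_symm_proj {v₀ : TM E M} {z : E × E} (hz : z ∈ (tchart v₀).target) :
    (extChartAt 𝓘(ℝ, E) v₀.proj).symm z.1 = ((tchart v₀).symm z).proj := by
  rw [← (tchart_symm_coords hz).1]
  exact (extChartAt 𝓘(ℝ, E) v₀.proj).left_inv (tchart_symm_mem hz)

theorem secRep_basic {v₀ : TM E M} {z : E × E} (hz : z ∈ (tchart v₀).target)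
    (X : (p : M) → TangentSpace 𝓘(ℝ, E) p) : secRep v₀ (basic X) z = baseRep v₀ X z.1 := by
  rw [baseRep, tchart_symm_proj hz]; rfl

theorem contDiffAt_baseRep {v₀ : TM E M} {x : E} (hx : x ∈ (extChartAt 𝓘(ℝ, E) v₀.proj).target)
    {X : (p : M) → TangentSpace 𝓘(ℝ, E) p} (hX : SmoothVectorField X) :
    ContDiffAt ℝ ∞ (baseRep v₀ X) x := by
  have hz : (x, (0 : E)) ∈ (tchart v₀).target := mem_tchart_target.2 hx
  have h1 : ContDiffAt ℝ ∞ (secRep v₀ (basic X)) (x, (0 : E)) :=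
    contDiffAt_secRep hz _ ((ContMDiff.comp hX (Bundle.contMDiff_proj (IB := 𝓘(ℝ, E))
      (TangentSpace 𝓘(ℝ, E) : M → Type _))).contMDiffAt)
  have h2 : ContDiffAt ℝ ∞ (fun x : E => (x, (0 : E))) x := contDiffAt_id.prodMk contDiffAt_const
  refine (h1.comp x h2).congr_of_eventuallyEq ?_
  filter_upwards [(isOpen_extChartAt_target v₀.proj).mem_nhds hx] with x' hx'
  exact (secRep_basic ((mem_tchart_target (z := (x', (0 : E)))).2 hx') X).symm

theorem contDiffAt_baseFun {v₀ : TM E M} {x : E} (hx : x ∈ (extChartAt 𝓘(ℝ, E) v₀.proj).target)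
    {f : M → ℝ} (hf : ContMDiffAt 𝓘(ℝ, E) 𝓘(ℝ, ℝ) ∞ f ((extChartAt 𝓘(ℝ, E) v₀.proj).symm x)) :
    ContDiffAt ℝ ∞ (baseFun v₀ f) x :=
  contMDiffAt_iff_contDiffAt.1 (hf.comp x ((contMDiffOn_extChartAt_symm v₀.proj).contMDiffAt
    ((isOpen_extChartAt_target v₀.proj).mem_nhds hx)))

theorem mfderiv_eq_fderiv_baseFun {v₀ : TM E M} {x : E}
    (hx : x ∈ (extChartAt 𝓘(ℝ, E) v₀.proj).target) {f : M → ℝ}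
    (hf : DifferentiableAt ℝ (baseFun v₀ f) x)
    (w : TangentSpace 𝓘(ℝ, E) ((extChartAt 𝓘(ℝ, E) v₀.proj).symm x)) :
    (mfderiv 𝓘(ℝ, E) 𝓘(ℝ, ℝ) f ((extChartAt 𝓘(ℝ, E) v₀.proj).symm x) w : ℝ) =
      fderiv ℝ (baseFun v₀ f) x (fibreMap v₀ ((extChartAt 𝓘(ℝ, E) v₀.proj).symm x) w) := by
  revert w
  set q := (extChartAt 𝓘(ℝ, E) v₀.proj).symm x with hq
  intro w
  have hqs : q ∈ (extChartAt 𝓘(ℝ, E) v₀.proj).source := (extChartAt 𝓘(ℝ, E) v₀.proj).map_target hx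
  have hxq : extChartAt 𝓘(ℝ, E) v₀.proj q = x := (extChartAt 𝓘(ℝ, E) v₀.proj).right_inv hx
  have h1 : HasMFDerivAt 𝓘(ℝ, E) 𝓘(ℝ, ℝ) (baseFun v₀ f) (extChartAt 𝓘(ℝ, E) v₀.proj q)
      (fderiv ℝ (baseFun v₀ f) x : E →L[ℝ] ℝ) := by
    rw [hxq]; exact hf.hasFDerivAt.hasMFDerivAt
  have h2 := h1.comp q (mdifferentiableAt_extChartAt (I := 𝓘(ℝ, E)) (x := v₀.proj) (y := q)
    (by simpa using hqs)).hasMFDerivAt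
  have h3 : baseFun v₀ f ∘ extChartAt 𝓘(ℝ, E) v₀.proj =ᶠ[𝓝 q] f := by
    filter_upwards [(isOpen_extChartAt_source (I := 𝓘(ℝ, E)) v₀.proj).mem_nhds hqs] with q' hq'
    exact congrArg f ((extChartAt 𝓘(ℝ, E) v₀.proj).left_inv hq')
  exact DFunLike.congr_fun (h2.congr_of_eventuallyEq h3.symm).mfderiv w

/-! ### Complete lifts in coordinates -/

theorem funRep_completeLiftFun {v₀ : TM E M} {z : E × E} (hz : z ∈ (tchart v₀).target) {f : M → ℝ}
    (hf : DifferentiableAt ℝ (baseFun v₀ f) z.1) :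
    funRep v₀ (completeLiftFun f) z = fderiv ℝ (baseFun v₀ f) z.1 z.2 := by
  have h1 := (tchart_symm_coords hz).2
  rw [funRep, completeLiftFun]
  rw [← h1]
  have h2 := tchart_symm_proj hz
  have aux : ∀ q : M, (extChartAt 𝓘(ℝ, E) v₀.proj).symm z.1 = q → ∀ w : TangentSpace 𝓘(ℝ, E) q,
      (mfderiv 𝓘(ℝ, E) 𝓘(ℝ, ℝ) f q w : ℝ) = fderiv ℝ (baseFun v₀ f) z.1 (fibreMap v₀ q w) := by
    rintro _ rfl w
    exact mfderiv_eq_fderiv_baseFun (mem_tchart_target.1 hz) hf w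
  exact aux _ h2 _

theorem hasFDerivAt_completeLiftFun {v₀ : TM E M} {z : E × E} (hz : z ∈ (tchart v₀).target)
    {f : M → ℝ} (hf : ContDiffAt ℝ ∞ (baseFun v₀ f) z.1) :
    HasFDerivAt (funRep v₀ (completeLiftFun f))
      ((fderiv ℝ (baseFun v₀ f) z.1).comp (ContinuousLinearMap.snd ℝ E E) +
        ((fderiv ℝ (fderiv ℝ (baseFun v₀ f)) z.1).comp (ContinuousLinearMap.fst ℝ E E)).flip z.2)
      z := by
  have h1 : HasFDerivAt (fun z : E × E => fderiv ℝ (baseFun v₀ f) z.1)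
      ((fderiv ℝ (fderiv ℝ (baseFun v₀ f)) z.1).comp (ContinuousLinearMap.fst ℝ E E)) z :=
    (contDiffAt_fderiv hf).diff.hasFDerivAt.comp z hasFDerivAt_fst
  refine (h1.clm_apply hasFDerivAt_snd).congr_of_eventuallyEq ?_
  filter_upwards [eventually_mem_target hz,
    continuous_fst.continuousAt.eventually (hf.two.eventually (by simp))] with z' hz' hf'
  exact funRep_completeLiftFun hz' (hf'.differentiableAt (by simp))

/-- The complete lift of a vector field in coordinates. -/
def completeLiftRep (v₀ : TM E M) (X : (p : M) → TangentSpace 𝓘(ℝ, E) p) (z : E × E) : E × E :=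
  (baseRep v₀ X z.1, fderiv ℝ (baseRep v₀ X) z.1 z.2)

theorem funRep_completeLiftFun_derivative {v₀ : TM E M} {z : E × E} (hz : z ∈ (tchart v₀).target)
    {X : (p : M) → TangentSpace 𝓘(ℝ, E) p} (hX : SmoothVectorField X) {f : M → ℝ}
    (hf : ContDiffAt ℝ ∞ (baseFun v₀ f) z.1) :
    funRep v₀ (completeLiftFun fun p => (mfderiv 𝓘(ℝ, E) 𝓘(ℝ, ℝ) f p (X p) : ℝ)) z =
      fderiv ℝ (baseFun v₀ f) z.1 (fderiv ℝ (baseRep v₀ X) z.1 z.2) +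
        fderiv ℝ (fderiv ℝ (baseFun v₀ f)) z.1 z.2 (baseRep v₀ X z.1) := by
  have hx := mem_tchart_target.1 hz
  have hXx := contDiffAt_baseRep hx hX
  have h2 := (contDiffAt_fderiv hf).diff.hasFDerivAt.clm_apply hXx.diff.hasFDerivAt
  have ev : (baseFun v₀ fun p => (mfderiv 𝓘(ℝ, E) 𝓘(ℝ, ℝ) f p (X p) : ℝ)) =ᶠ[𝓝 z.1]
      fun x => fderiv ℝ (baseFun v₀ f) x (baseRep v₀ X x) := by
    filter_upwards [(isOpen_extChartAt_target v₀.proj).mem_nhds hx,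
      hf.two.eventually (by simp)] with x' hx' hf'
    exact mfderiv_eq_fderiv_baseFun hx' (hf'.differentiableAt (by simp)) _
  have h3 := h2.congr_of_eventuallyEq ev
  rw [funRep_completeLiftFun hz h3.differentiableAt, h3.fderiv]
  rfl

/-- The condition `s (fᶜ) = (X f)ᶜ` on a tangent vector `s` of the tangent manifold. -/
def IsCompleteLiftAt (X : (p : M) → TangentSpace 𝓘(ℝ, E) p) (u : TM E M)
    (s : TangentSpace 𝓘(ℝ, E).tangent u) : Prop :=
  ∀ f : M → ℝ, ContMDiffAt 𝓘(ℝ, E) 𝓘(ℝ, ℝ) ∞ f u.proj →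
    (mfderiv 𝓘(ℝ, E).tangent 𝓘(ℝ, ℝ) (completeLiftFun f) u s : ℝ) =
      completeLiftFun (fun p => (mfderiv 𝓘(ℝ, E) 𝓘(ℝ, ℝ) f p (X p) : ℝ)) u

/-- Puts the intrinsic condition into an arbitrary chart; through it the value found in one chart is
transferred to all others. -/
theorem isCompleteLiftAt_iff {v₀ u : TM E M} (hu : u ∈ (tchart v₀).source)
    {X : (p : M) → TangentSpace 𝓘(ℝ, E) p} (hX : SmoothVectorField X)
    (s : TangentSpace 𝓘(ℝ, E).tangent u) :
    IsCompleteLiftAt X u s ↔ ∀ f : M → ℝ, ContDiffAt ℝ ∞ (baseFun v₀ f) (tchart v₀ u).1 →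
      fderiv ℝ (baseFun v₀ f) (tchart v₀ u).1 (tfibreMap v₀ u s).2 +
        fderiv ℝ (fderiv ℝ (baseFun v₀ f)) (tchart v₀ u).1 (tfibreMap v₀ u s).1 (tchart v₀ u).2 =
      fderiv ℝ (baseFun v₀ f) (tchart v₀ u).1
          (fderiv ℝ (baseRep v₀ X) (tchart v₀ u).1 (tchart v₀ u).2) +
        fderiv ℝ (fderiv ℝ (baseFun v₀ f)) (tchart v₀ u).1 (tchart v₀ u).2
          (baseRep v₀ X (tchart v₀ u).1) := by
  have hz := (tchart v₀).map_source hu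
  have hzu := (tchart v₀).left_inv hu
  have hx := mem_tchart_target.1 hz
  have hp : (extChartAt 𝓘(ℝ, E) v₀.proj).symm (tchart v₀ u).1 = u.proj := by
    rw [tchart_symm_proj hz, hzu]
  have hsm : ∀ f : M → ℝ, ContMDiffAt 𝓘(ℝ, E) 𝓘(ℝ, ℝ) ∞ f u.proj ↔
      ContDiffAt ℝ ∞ (baseFun v₀ f) (tchart v₀ u).1 := fun f => by
    refine ⟨fun hf => contDiffAt_baseFun hx (by rwa [hp]), fun hf => ?_⟩
    have hus := mem_tchart_source.1 hu
    have h1 : ContMDiffAt 𝓘(ℝ, E) 𝓘(ℝ, E) ∞ (extChartAt 𝓘(ℝ, E) v₀.proj) u.proj :=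
      contMDiffAt_extChartAt' (by simpa using hus)
    have h2 := (contMDiffAt_iff_contDiffAt.2 hf).comp u.proj h1
    refine h2.congr_of_eventuallyEq ?_
    filter_upwards [(isOpen_extChartAt_source (I := 𝓘(ℝ, E)) v₀.proj).mem_nhds hus] with q hq
    exact (congrArg f ((extChartAt 𝓘(ℝ, E) v₀.proj).left_inv hq)).symm
  have hl : ∀ f : M → ℝ, ContDiffAt ℝ ∞ (baseFun v₀ f) (tchart v₀ u).1 →
      (mfderiv 𝓘(ℝ, E).tangent 𝓘(ℝ, ℝ) (completeLiftFun f) u s : ℝ) =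
      fderiv ℝ (baseFun v₀ f) (tchart v₀ u).1 (tfibreMap v₀ u s).2 +
        fderiv ℝ (fderiv ℝ (baseFun v₀ f)) (tchart v₀ u).1 (tfibreMap v₀ u s).1
          (tchart v₀ u).2 := fun f hf => by
    have h1 := hasFDerivAt_completeLiftFun hz hf
    have h2 := funRep_applyField hz (constField v₀ (tfibreMap v₀ u s)) h1.differentiableAt
    rw [funRep_tchart hu, applyField, constField_apply hu, fieldRep_constField _ hz,
      h1.fderiv] at h2
    exact h2
  have hr : ∀ f : M → ℝ, ContDiffAt ℝ ∞ (baseFun v₀ f) (tchart v₀ u).1 → _ := fun f hf =>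
    (funRep_tchart hu (completeLiftFun fun p => (mfderiv 𝓘(ℝ, E) 𝓘(ℝ, ℝ) f p (X p) : ℝ))).symm.trans
      (funRep_completeLiftFun_derivative hz hX hf)
  constructor
  · intro h f hf
    rw [← hl f hf, ← hr f hf]
    exact h f ((hsm f).2 hf)
  · intro h f hf
    rw [hl f ((hsm f).1 hf), hr f ((hsm f).1 hf)]
    exact h f ((hsm f).1 hf)

theorem isCompleteLiftAt_of_rep {v₀ u : TM E M} (hu : u ∈ (tchart v₀).source)
    {X : (p : M) → TangentSpace 𝓘(ℝ, E) p} (hX : SmoothVectorField X)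
    {s : TangentSpace 𝓘(ℝ, E).tangent u}
    (h : tfibreMap v₀ u s = completeLiftRep v₀ X (tchart v₀ u)) : IsCompleteLiftAt X u s := by
  rw [isCompleteLiftAt_iff hu hX, h]
  intro f hf
  rw [completeLiftRep, fderiv_fderiv_symm hf]

theorem fderiv_fderiv_sq (l : E →L[ℝ] ℝ) (x a b : E) :
    fderiv ℝ (fderiv ℝ fun x => l x ^ 2) x a b = 2 * (l a * l b) := by
  have h1 : (fderiv ℝ fun x => l x ^ 2) = fun x => (2 * l x) • l := by
    funext y
    rw [(l.hasFDerivAt.pow 2).fderiv]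
    simp
  have h2 : HasFDerivAt (fun x => (2 * l x) • l) (((2 : ℝ) • l).smulRight l) x := by
    exact (l.hasFDerivAt.const_mul 2).smul_const l
  rw [h1, h2.fderiv]
  simp
  ring

/-- Linear test functions have no second derivative and determine the fibre component. Squares of
linear functions then determine the base component, except at zero vectors, where the second-order
term vanishes; hence the alternative in `h'`. -/
theorem IsCompleteLiftAt.rep {v₀ u : TM E M} (hu : u ∈ (tchart v₀).source)
    {X : (p : M) → TangentSpace 𝓘(ℝ, E) p} (hX : SmoothVectorField X)
    {s : TangentSpace 𝓘(ℝ, E).tangent u} (h : IsCompleteLiftAt X u s)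
    (h' : (tfibreMap v₀ u s).1 = baseRep v₀ X (tchart v₀ u).1 ∨ u ∈ slit E M) :
    tfibreMap v₀ u s = completeLiftRep v₀ X (tchart v₀ u) := by
  rw [isCompleteLiftAt_iff hu hX] at h
  have hx := mem_tchart_target.1 ((tchart v₀).map_source hu)
  have key : ∀ k : E → ℝ, ContDiff ℝ ∞ k →
      fderiv ℝ k (tchart v₀ u).1 (tfibreMap v₀ u s).2 +
        fderiv ℝ (fderiv ℝ k) (tchart v₀ u).1 (tfibreMap v₀ u s).1 (tchart v₀ u).2 =
      fderiv ℝ k (tchart v₀ u).1 (fderiv ℝ (baseRep v₀ X) (tchart v₀ u).1 (tchart v₀ u).2) +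
        fderiv ℝ (fderiv ℝ k) (tchart v₀ u).1 (tchart v₀ u).2
          (baseRep v₀ X (tchart v₀ u).1) := fun k hk => by
    have ev : baseFun v₀ (k ∘ extChartAt 𝓘(ℝ, E) v₀.proj) =ᶠ[𝓝 (tchart v₀ u).1] k := by
      filter_upwards [(isOpen_extChartAt_target v₀.proj).mem_nhds hx] with x' hx'
      exact congrArg k ((extChartAt 𝓘(ℝ, E) v₀.proj).right_inv hx')
    have := h (k ∘ extChartAt 𝓘(ℝ, E) v₀.proj) (hk.contDiffAt.congr_of_eventuallyEq ev)
    rwa [ev.fderiv_eq, ev.fderiv.fderiv_eq] at this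
  have h2 : (tfibreMap v₀ u s).2 = fderiv ℝ (baseRep v₀ X) (tchart v₀ u).1 (tchart v₀ u).2 := by
    refine (SeparatingDual.eq_iff_forall_dual_eq (R := ℝ)).2 fun l => ?_
    have h1 : fderiv ℝ (l : E → ℝ) = fun _ => l := funext fun y => l.fderiv
    have := key l l.contDiff
    rw [h1] at this
    simpa using this
  refine Prod.ext ?_ h2
  rcases h' with h' | hs
  · exact h'
  by_contra hne
  -- One functional that detects both the supposed difference and y; the square of `l` only yields
  -- equality of products with the factor `l` of y, which is then cancelled.
  obtain ⟨l, hl1, hl2⟩ := SeparatingDual.exists_eq_one_ne_zero_of_ne_zero_pair (R := ℝ)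
    (sub_ne_zero.2 hne) (tchart_mem_dom hu hs).2
  have := key (fun x => l x ^ 2) (l.contDiff.pow 2)
  rw [fderiv_fderiv_sq, fderiv_fderiv_sq, h2] at this
  have h3 : l (tfibreMap v₀ u s).1 * l (tchart v₀ u).2 =
      l (baseRep v₀ X (tchart v₀ u).1) * l (tchart v₀ u).2 := by linarith
  have h4 := mul_right_cancel₀ hl2 h3
  rw [map_sub, completeLiftRep, h4, sub_self] at hl1
  exact zero_ne_one hl1

/-- The complete lift of a vector field on `M`. -/
def completeLift (X : (p : M) → TangentSpace 𝓘(ℝ, E) p) : Field E M := fun v =>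
  completeLiftRep v X (tchart v v)

/-- The pointwise definition is characterised intrinsically by its action on lifted functions,
together with its projection to `X`. The projection is needed so that the argument covers zero
vectors as well. -/
theorem fieldRep_completeLift {v₀ : TM E M} {X : (p : M) → TangentSpace 𝓘(ℝ, E) p}
    (hX : SmoothVectorField X) {z : E × E} (hz : z ∈ (tchart v₀).target) :
    fieldRep v₀ (completeLift X) z = completeLiftRep v₀ X z := by
  set u := (tchart v₀).symm z with hu
  have h₀ : u ∈ (tchart v₀).source := (tchart v₀).map_target hz
  have h₁ : u ∈ (tchart u).source := mem_extChartAt_source u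
  have hz' : tchart v₀ u = z := (tchart v₀).right_inv hz
  have h1 : IsCompleteLiftAt X u (completeLift X u) :=
    isCompleteLiftAt_of_rep h₁ hX (by rw [tfibreMap_self]; rfl)
  have h2 : proj u (completeLift X u) = X u.proj := by
    have h3 := secRep_projSec ((tchart u).map_source h₁) (completeLift X)
    rw [secRep_self, fieldRep_self] at h3
    refine h3.trans ?_
    have h4 := secRep_basic ((tchart u).map_source h₁) X
    rw [secRep_self] at h4
    exact h4.symm
  have h5 : (tfibreMap v₀ u (completeLift X u)).1 = baseRep v₀ X (tchart v₀ u).1 := by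
    rw [hz', ← secRep_basic hz]
    refine (fst_mfderiv_chart v₀ u h₀ (completeLift X u)).trans ?_
    rw [h2]; rfl
  rw [← hz']
  exact (fieldRep_tchart h₀ _).trans (h1.rep h₀ hX (Or.inl h5))

theorem contDiffAt_completeLiftRep {v₀ : TM E M} {X : (p : M) → TangentSpace 𝓘(ℝ, E) p}
    (hX : SmoothVectorField X) {z : E × E} (hz : z ∈ (tchart v₀).target) :
    ContDiffAt ℝ ∞ (completeLiftRep v₀ X) z := by
  have h := contDiffAt_baseRep (mem_tchart_target.1 hz) hX
  exact (h.comp z contDiffAt_fst).prodMk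
    (((contDiffAt_fderiv h).comp z contDiffAt_fst).clm_apply contDiffAt_snd)

theorem isCompleteLift_completeLift [CompleteSpace E] {X : (p : M) → TangentSpace 𝓘(ℝ, E) p}
    (hX : SmoothVectorField X) : IsCompleteLift X (completeLift X) where
  smooth v := by
    have h := mem_extChartAt_source (I := 𝓘(ℝ, E).tangent) v
    have hz := (tchart v).map_source h
    exact contMDiffAt_toMap_of_fieldRep h _
      ((contDiffAt_completeLiftRep hX hz).congr_of_eventuallyEq
        ((eventually_mem_target hz).mono fun _ hz => fieldRep_completeLift hX hz))
  eq v f hf := (isCompleteLiftAt_of_rep (mem_extChartAt_source v) hX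
    (by rw [tfibreMap_self]; rfl) : IsCompleteLiftAt X v (completeLift X v)) f hf

/-! ### The canonical connection -/

variable [FiniteDimensional ℝ E] [T2Space M] [CompleteSpace E] {F : TM E M → ℝ}

/-- The value of the canonical connection on basic sections, in any chart. -/
theorem IsFinslerFunction.tfibreMap_generated (hF : IsFinslerFunction F) {v₀ u : TM E M}
    (hu : u ∈ (tchart v₀).source) (hs : u ∈ slit E M) {X : (p : M) → TangentSpace 𝓘(ℝ, E) p}
    (hX : SmoothVectorField X) {Xc : Field E M} (hXc : IsCompleteLift X Xc) :
    tfibreMap v₀ u ((1 / 2 : ℝ) • (Xc u + bracket (vertField (basic X)) (canonicalSpray F) u)) =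
      hor (finslerCoeff F v₀) (tchart v₀ u) (fibreMap v₀ u.proj (X u.proj)) := by
  have hz := tchart_mem_dom hu hs
  have hG := (hF.isSprayData v₀).smooth_coeff _ hz
  have h1 : tfibreMap v₀ u (Xc u) = completeLiftRep v₀ X (tchart v₀ u) :=
    IsCompleteLiftAt.rep hu hX (hXc.eq u) (Or.inr hs)
  have h2 : tfibreMap v₀ u (bracket (vertField (basic X)) (canonicalSpray F) u) = _ :=
    (fieldRep_tchart hu _).symm.trans (fieldRep_bracket hz.1
      ((smoothSec_basic hX).vertField.contDiffAt hz)
      (hF.isCanonicalSpray.smooth.contDiffAt hz))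
  have hb := secRep_basic hz.1 X
  have hS : HasFDerivAt (fun z : E × E => (z.2, (-2 : ℝ) • finslerCoeff F v₀ z))
      ((ContinuousLinearMap.snd ℝ E E).prod ((-2 : ℝ) • fderiv ℝ (finslerCoeff F v₀)
        (tchart v₀ u))) (tchart v₀ u) :=
    hasFDerivAt_snd.prodMk (hG.diff.hasFDerivAt.const_smul (-2 : ℝ))
  have hX' : HasFDerivAt (fun z : E × E => ((0 : E), baseRep v₀ X z.1))
      ((0 : E × E →L[ℝ] E).prod ((fderiv ℝ (baseRep v₀ X) (tchart v₀ u).1).comp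
        (ContinuousLinearMap.fst ℝ E E))) (tchart v₀ u) :=
    (hasFDerivAt_const (0 : E) _).prodMk
      ((contDiffAt_baseRep (mem_tchart_target.1 hz.1) hX).diff.hasFDerivAt.comp _ hasFDerivAt_fst)
  rw [fderiv_congr (eventuallyEq_of_dom hz fun z hz => hF.fieldRep_canonicalSpray hz),
    fderiv_congr (eventuallyEq_of_dom hz fun z hz => (fieldRep_vertField hz.1 (basic X)).trans
      (by rw [secRep_basic hz.1])), hF.fieldRep_canonicalSpray hz, fieldRep_vertField hz.1,
    hb, hS.fderiv, hX'.fderiv] at h2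
  have hb' : (fibreMap v₀ u.proj (X u.proj) : E) = baseRep v₀ X (tchart v₀ u).1 := by
    rw [← hb, secRep_tchart hu]; rfl
  have h3 := (map_smul (tfibreMap v₀ u) (1 / 2 : ℝ)
    (Xc u + bracket (vertField (basic X)) (canonicalSpray F) u)).trans
    (congrArg ((1 / 2 : ℝ) • ·) ((map_add (tfibreMap v₀ u) _ _).trans (congrArg₂ (· + ·) h1 h2)))
  refine h3.trans ?_
  -- The complete lift is (X, DX y) and the bracket is (X, -2G'X - DX y), so half their sum is (X,
  -- -G'X).
  rw [hb', hor_apply, completeLiftRep]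
  refine Prod.ext ?_ ?_
  · simp
    module
  · simp [vd_apply]

/-- The canonical connection, built from its coordinate expression. -/
def finslerConn (F : TM E M → ℝ) : Conn E M := fun v =>
  open Classical in
  if v ∈ slit E M then (hor (finslerCoeff F v) (tchart v v) : E →L[ℝ] E × E) else
    (mfderiv 𝓘(ℝ, E) 𝓘(ℝ, E).tangent (fun q : M => (⟨q, 0⟩ : TM E M)) v.proj : E →L[ℝ] E × E)

theorem IsFinslerFunction.finslerConn_apply (hF : IsFinslerFunction F) {v : TM E M}
    (hv : v ∈ slit E M) {X : (p : M) → TangentSpace 𝓘(ℝ, E) p} (hX : SmoothVectorField X)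
    {Xc : Field E M} (hXc : IsCompleteLift X Xc) :
    finslerConn F v (X v.proj) =
      (1 / 2 : ℝ) • (Xc v + bracket (vertField (basic X)) (canonicalSpray F) v) := by
  have h := hF.tfibreMap_generated (mem_extChartAt_source v) hv hX hXc
  rw [tfibreMap_self, fibreMap_self] at h
  have h2 : finslerConn F v = (hor (finslerCoeff F v) (tchart v v) : E →L[ℝ] E × E) := if_pos hv
  rw [h2]
  exact h.symm

/-- The formula on basic sections fixes `H` over the slit manifold, because each tangent vector
extends to a global field and each such field has a complete lift to insert. -/
theorem IsFinslerFunction.hasCoeffs_of_eq (hF : IsFinslerFunction F) {H : Conn E M}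
    (hH : ∀ X : (p : M) → TangentSpace 𝓘(ℝ, E) p, SmoothVectorField X →
      ∀ Xc : Field E M, IsCompleteLift X Xc → ∀ v ∈ slit E M, horField H (basic X) v =
        (1 / 2 : ℝ) • (Xc v + bracket (vertField (basic X)) (canonicalSpray F) v)) :
    HasCoeffs H (finslerCoeff F) where
  smooth v₀ z hz := (hF.isSprayData v₀).smooth_coeff z hz
  eq v₀ z hz w := by
    obtain ⟨X, hX, hXw⟩ := exists_smoothVectorField _ w
    have h1 := hH X hX _ (isCompleteLift_completeLift hX) _ (tchart_symm_mem_slit hz)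
    have h2 := hF.tfibreMap_generated ((tchart v₀).map_target hz.1) (tchart_symm_mem_slit hz) hX
      (isCompleteLift_completeLift hX)
    rw [← h1, (tchart v₀).right_inv hz.1, hXw] at h2
    rw [← h2, ← hXw]
    rfl

theorem IsFinslerFunction.isGeneratedBy_finslerConn (hF : IsFinslerFunction F) :
    IsGeneratedBy (canonicalSpray F) (finslerConn F) := by
  have heq : ∀ X : (p : M) → TangentSpace 𝓘(ℝ, E) p, SmoothVectorField X →
      ∀ Xc : Field E M, IsCompleteLift X Xc → ∀ v ∈ slit E M, horField (finslerConn F) (basic X) v =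
        (1 / 2 : ℝ) • (Xc v + bracket (vertField (basic X)) (canonicalSpray F) v) :=
    fun X hX Xc hXc v hv => hF.finslerConn_apply hv hX hXc
  have hzero : ∀ (p : M) (w : TangentSpace 𝓘(ℝ, E) p), finslerConn F (⟨p, 0⟩ : TM E M) w =
      mfderiv 𝓘(ℝ, E) 𝓘(ℝ, E).tangent (fun q : M => (⟨q, 0⟩ : TM E M)) p w := fun p w => by
    have h : finslerConn F (⟨p, 0⟩ : TM E M) =
        (mfderiv 𝓘(ℝ, E) 𝓘(ℝ, E).tangent (fun q : M => (⟨q, 0⟩ : TM E M)) p : E →L[ℝ] E × E) :=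
      if_neg fun h => h rfl
    rw [h]
  refine ⟨⟨fun v w => ?_, fun X hX => (hF.hasCoeffs_of_eq heq).smooth_horField hX, hzero⟩, heq⟩
  by_cases hv : v ∈ slit E M
  · classical
    -- The splitting is pointwise, so an arbitrary, possibly discontinuous section with value `w` at
    -- `v` suffices.
    have h1 := secRep_projSec ((tchart v).map_source (mem_extChartAt_source v))
      (horField (finslerConn F) fun u => if h : u = v then (w : E) else 0)
    rw [secRep_self, fieldRep_self] at h1
    have h2 : finslerConn F v = (hor (finslerCoeff F v) (tchart v v) : E →L[ℝ] E × E) := if_pos hv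
    simp only [projSec, horField, dif_pos, h2] at h1
    rw [h2]
    exact h1
  · obtain ⟨p, y⟩ := v
    have hy : y = 0 := not_not.1 hv
    subst hy
    rw [hzero]
    have h0 : MDifferentiableAt 𝓘(ℝ, E) 𝓘(ℝ, E).tangent (fun q : M => (⟨q, 0⟩ : TM E M)) p :=
      (Bundle.contMDiff_zeroSection (n := 1) ℝ
        (TangentSpace 𝓘(ℝ, E) : M → Type _)).mdifferentiableAt one_ne_zero
    -- On zero vectors the splitting is the chain rule for the projection composed with the zero
    -- section, which is the identity.
    have h1 := ((proj_mdiff (⟨p, 0⟩ : TM E M)).hasMFDerivAt.comp (x := p) h0.hasMFDerivAt).mfderiv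
    have h2 : mfderiv 𝓘(ℝ, E) 𝓘(ℝ, E)
        ((fun u : TM E M => u.proj) ∘ fun q : M => (⟨q, 0⟩ : TM E M)) p =
        ContinuousLinearMap.id ℝ _ := mfderiv_id
    exact (DFunLike.congr_fun (h1.symm.trans h2) w)

theorem IsFinslerFunction.hasCoeffs_canonicalConnection (hF : IsFinslerFunction F) :
    HasCoeffs (canonicalConnection F) (finslerCoeff F) :=
  hF.hasCoeffs_of_eq (Classical.epsilon_spec ⟨_, hF.isGeneratedBy_finslerConn⟩ :
    IsGeneratedBy (canonicalSpray F) (canonicalConnection F)).eq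

end ConnectionExistence

end Finsler

end

/-! ### The theorem. -/

theorem mainTheorem5 {E : Type*} [NormedAddCommGroup E] [NormedSpace ℝ E] [FiniteDimensional ℝ E]
    {M : Type*} [TopologicalSpace M] [ChartedSpace E M] [IsManifold 𝓘(ℝ, E) ∞ M]
    [T2Space M] [SecondCountableTopology M]
    (F : Finsler.TM E M → ℝ) (hF : Finsler.IsFinslerFunction F) :
    (∀ X Y Z U : Finsler.Sec E M, Finsler.SmoothSec X → Finsler.SmoothSec Y →
      Finsler.SmoothSec Z → Finsler.SmoothSec U → ∀ v ∈ Finsler.slit E M,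
        Finsler.vDiffFun (Finsler.energy F)
            (Finsler.vDiffAffineCurvature (Finsler.canonicalConnection F) X Y Z U) v =
          Finsler.stretch F Z Y X U v) ∧
    (Finsler.IsRQuadratic (Finsler.canonicalConnection F) →
      ∀ X Y Z U : Finsler.Sec E M, Finsler.SmoothSec X → Finsler.SmoothSec Y →
        Finsler.SmoothSec Z → Finsler.SmoothSec U → ∀ v ∈ Finsler.slit E M,
          Finsler.stretch F X Y Z U v = 0) := by
  have := FiniteDimensional.complete ℝ E
  have main : ∀ X Y Z U : Finsler.Sec E M, Finsler.SmoothSec X → Finsler.SmoothSec Y →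
      Finsler.SmoothSec Z → Finsler.SmoothSec U → ∀ v ∈ Finsler.slit E M,
        Finsler.vDiffFun (Finsler.energy F)
            (Finsler.vDiffAffineCurvature (Finsler.canonicalConnection F) X Y Z U) v =
          Finsler.stretch F Z Y X U v := fun X Y Z U hX hY hZ hU v hv =>
    Finsler.vDiffFun_vDiffAffineCurvature_eq_stretch hF.smooth hF.hasCoeffs_canonicalConnection
      hF.isSprayData hv hX hY hZ hU
  refine ⟨main, fun hR X Y Z U hX hY hZ hU v hv => ?_⟩
  -- The identity interchanges the first and third arguments, so it is used with `X` and `Z`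
  -- exchanged; the form ∇ᵛE is then evaluated on the zero vector.
  rw [← main Z Y X U hZ hY hX hU v hv, Finsler.vDiffFun, Finsler.applyField, Finsler.vertField,
    hR Z Y X U hZ hY hX hU v hv]
  exact (congrArg _ (map_zero _)).trans (map_zero _)
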